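/- Let $\Gamma\subset\mathrm{PSL}(2,\mathbb R)$ be a torsion-free cocompact Fuchsian group (a discrete subgroup without nontrivial elements of finite order and with compact quotient) acting on the upper half-plane $\mathbb H=\{z=x+iy : y>0\}$, and let $X=\Gamma\backslash\mathbb H$ be the corresponding compact hyperbolic Riemann surface, with hyperbolic metric $\mu^{\mathrm{hyp}}_X(z)=\frac{i}{2}\cdot\frac{dz\wedge d\bar z}{y^2}=\frac{dx\,dy}{y^2}$ and injectivity radius $$r_X:=\inf\{d_{\mathbb H}(z,\gamma z) : z\in\mathbb H,\ \gamma\in\Gamma\setminus\{\mathrm{Id}\}\},$$ where $d_{\mathbb H}$ is the hyperbolic distance. Fix a fundamental domain $X_\Gamma\subset\mathbb H$ of $\Gamma$. For an integer $k$, let $H^0(X,\Omega_X^{\otimes k})$ be the space of holomorphic $k$-differentials $\omega=f(z)\,dz^{\otimes k}$, where $f$ is holomorphic on $\mathbb H$ and $f(\gamma z)=(cz+d)^{2k}f(z)$ for all $\gamma=\begin{pmatrix}a&b\\c&d\end{pmatrix}\in\Gamma$. Equip it with the pointwise norm $\|\omega\|_{\mathrm{hyp}}(z)=y^k|f(z)|$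 and with the inner product $$\langle f\,dz^{\otimes k},\,g\,dz^{\otimes k}\rangle_{\mathrm{hyp}}=\int_{X_\Gamma}y^{2k}f(z)\overline{g(z)}\,\frac{dx\,dy}{y^2}.$$ Let $k\ge 3$. Then $H^0(X,\Omega_X^{\otimes k})$ has a finite orthonormal basis, and the following holds for every orthonormal basis $\omega_1,\dots,\omega_n$ of it. Let $$\mathcal B^k_X(z):=\sum_{i=1}^n\|\omega_i\|^2_{\mathrm{hyp}}(z),\qquad \mu^{\mathrm{Ber},k}_X(z):=-\frac{i}{2\pi}\,\partial\overline\partial\log\mathcal B^k_X(z)$$ be the Bergman kernel and the weight-$k$ Bergman metric, and put $$C_{X,k}:=\frac{2k-1}{4\pi}\left(2+\frac{16}{\cosh^{2k-4}(r_X/4)}+\frac{8}{\cosh^{2k-3}(r_X/2)}\right)+\frac{2k-1}{2\pi\sinh^2(r_X/4)}\left(\frac{1}{(2k-2)\cosh^{2k-3}(r_X/2)}+\frac{1}{(k-2)\cosh^{2k-4}(r_X/2)}\right).$$ Then, for every $z\in X$, $$\left|\frac{\mu^{\mathrm{Ber},k}_X(z)}{\mu^{\mathrm{hyp}}_X(z)}\right|\le\frac{k^2}{\pi}\cdot\frac{C_{X,k}}{\mathcal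 B^k_X(z)}\cdot\left(\frac{4C_{X,k}}{\mathcal B^k_X(z)}+5+\frac{1}{2k}\right)+\frac{k}{2\pi}.$$ -/

import Mathlib

open UpperHalfPlane MeasureTheory
open scoped MatrixGroups Manifold ComplexConjugate

noncomputable section

namespace HypSurface

/-- The action of `PSL(2, ℝ)` on the upper half-plane by Möbius transformations. -/
instance pslAction : MulAction PSL(2, ℝ) ℍ :=
  MulAction.compHom ℍ (Matrix.ProjectiveSpecialLinearGroup.toPGL (n := Fin 2) (R := ℝ))

/-- The class of a matrix `g` in `PSL(2, ℝ)` acts by `z ↦ (a z + b) / (c z + d)`. -/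
theorem psl_mk_smul (g : SL(2, ℝ)) (z : ℍ) : (QuotientGroup.mk g : PSL(2, ℝ)) • z = g • z := by
  rw [MulAction.compHom_smul_def, Matrix.ProjectiveSpecialLinearGroup.toPGL_mk, pglMk_smul,
    MulAction.compHom_smul_def]
  congr 1

/-- `Γ` is a torsion-free cocompact Fuchsian group: a discrete subgroup of `PSL(2, ℝ)` without
nontrivial elements of finite order, whose quotient `Γ \ ℍ` is compact. -/
structure IsSurfaceGroup (Γ : Subgroup PSL(2, ℝ)) : Prop where
  discrete : DiscreteTopology Γ
  torsionFree : ∀ γ ∈ Γ, γ ≠ 1 → ¬ IsOfFinOrder γ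
  cocompact : CompactSpace (MulAction.orbitRel.Quotient Γ ℍ)

/-- The Riemann surface `X = Γ \ ℍ` (as a set of orbits). -/
abbrev Surface (Γ : Subgroup PSL(2, ℝ)) : Type := MulAction.orbitRel.Quotient Γ ℍ

/-- The universal covering `ℍ → X`. -/
def proj (Γ : Subgroup PSL(2, ℝ)) (z : ℍ) : Surface Γ := Quotient.mk _ z

/-- The injectivity radius
`r_X = inf {d(z, γ z) | z ∈ ℍ, γ ∈ Γ, γ ≠ 1}`, for the hyperbolic distance `d` of `ℍ`. -/
def injRadius (Γ : Subgroup PSL(2, ℝ)) : ℝ :=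
  sInf {r : ℝ | ∃ z : ℍ, ∃ γ ∈ Γ, γ ≠ 1 ∧ r = dist z (γ • z)}

/-- `H⁰(X, Ω^k)`: a holomorphic `k`-differential on `X = Γ \ ℍ` is a `Γ`-invariant holomorphic
`k`-differential `f(z) dz^k` on `ℍ`, that is, a holomorphic `f` with
`f(γ z) = (c z + d)^(2k) f(z)` for all `γ ∈ Γ`
(recall that `d(γ z) = (c z + d)^(-2) dz`). -/
def kDifferentials (Γ : Subgroup PSL(2, ℝ)) (k : ℕ) : Submodule ℂ (ℍ → ℂ) where
  carrier := {f | MDifferentiable 𝓘(ℂ) 𝓘(ℂ) f ∧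
    ∀ g : SL(2, ℝ), (QuotientGroup.mk g : PSL(2, ℝ)) ∈ Γ → ∀ z : ℍ,
      f (g • z) = (((g 1 0 : ℝ) : ℂ) * z + ((g 1 1 : ℝ) : ℂ)) ^ (2 * k) * f z}
  add_mem' := fun ⟨ha, ha'⟩ ⟨hb, hb'⟩ =>
    ⟨ha.add hb, fun g hg z => by simp only [Pi.add_apply, ha' g hg z, hb' g hg z, mul_add]⟩
  zero_mem' := ⟨mdifferentiable_const, fun g _ z => by simp⟩
  smul_mem' := fun c _ ⟨ha, ha'⟩ =>
    ⟨ha.const_smul c, fun g hg z => by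
      simp only [Pi.smul_apply, smul_eq_mul, ha' g hg z]; ring⟩

/-- `y^k |f(z)|` is a `Γ`-invariant function. -/
theorem norm_invariant {Γ : Subgroup PSL(2, ℝ)} {k : ℕ} (ω : kDifferentials Γ k)
    (z w : ℍ) (h : (MulAction.orbitRel Γ ℍ) z w) :
    z.im ^ k * ‖ω.1 z‖ = w.im ^ k * ‖ω.1 w‖ := by
  obtain ⟨⟨γ, hγ⟩, rfl⟩ := h
  obtain ⟨g, rfl⟩ := QuotientGroup.mk_surjective γ
  have hs : (⟨(QuotientGroup.mk g : PSL(2, ℝ)), hγ⟩ : Γ) • w = g • w := psl_mk_smul g w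
  have hden : denom (Matrix.SpecialLinearGroup.mapGL ℝ g) w
      = ((g 1 0 : ℝ) : ℂ) * w + ((g 1 1 : ℝ) : ℂ) := by
    simp [denom]
  have hne := denom_ne_zero (Matrix.SpecialLinearGroup.mapGL ℝ g) w
  have him : (g • w).im = w.im / ‖((g 1 0 : ℝ) : ℂ) * w + ((g 1 1 : ℝ) : ℂ)‖ ^ 2 := by
    rw [MulAction.compHom_smul_def, im_smul_eq_div_normSq, hden, Complex.normSq_eq_norm_sq]
    simp
  rw [hden] at hne
  have hne' := norm_ne_zero_iff.mpr hne
  change (_ • w).im ^ k * ‖ω.1 (_ • w)‖ = _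
  rw [hs, ω.2.2 g hγ w, him, norm_mul, norm_pow, div_pow, ← pow_mul]
  field_simp

/-- The pointwise norm `‖ω‖_hyp(z) = y^k |f(z)|` on `X` of `ω = f(z) dz^k`. -/
def hypNorm {Γ : Subgroup PSL(2, ℝ)} {k : ℕ} (ω : kDifferentials Γ k) : Surface Γ → ℝ :=
  Quotient.lift (fun z : ℍ => z.im ^ k * ‖ω.1 z‖) (norm_invariant ω)

/-- The `L²` inner product `∫_F y^(2k) f(z) conj(g(z)) dx dy / y^2` of `f dz^k` and `g dz^k`, where
`F` is a fundamental domain; `volume` on `ℍ` is the hyperbolic measure `dx dy / y^2`. -/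
def l2Inner {Γ : Subgroup PSL(2, ℝ)} {k : ℕ} (F : Set ℍ) (ω η : kDifferentials Γ k) : ℂ :=
  ∫ z in F, ((z.im : ℝ) : ℂ) ^ (2 * k) * ω.1 z * conj (η.1 z) ∂(volume : Measure ℍ)

/-- The family `ω` is orthonormal for the `L²` inner product. -/
def IsL2Orthonormal {Γ : Subgroup PSL(2, ℝ)} {k n : ℕ} (F : Set ℍ)
    (ω : Fin n → kDifferentials Γ k) : Prop :=
  ∀ i j, l2Inner F (ω i) (ω j) = if i = j then 1 else 0

/-- The Bergman kernel `B(x) = ∑ i, ‖ω_i‖_hyp(x)^2` on `X` of the family `ω`, to be used for an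
orthonormal basis `ω` of `H⁰(X, Ω^k)`. -/
def bergmanKernel {Γ : Subgroup PSL(2, ℝ)} {k n : ℕ}
    (ω : Fin n → kDifferentials Γ k) (x : Surface Γ) : ℝ :=
  ∑ i, hypNorm (ω i) x ^ 2

/-- `∂u/∂z = (∂u/∂x - i ∂u/∂y) / 2`. -/
def wirtingerZ (u : ℂ → ℂ) (z : ℂ) : ℂ :=
  (fderiv ℝ u z 1 - Complex.I * fderiv ℝ u z Complex.I) / 2

/-- `∂u/∂z̄ = (∂u/∂x + i ∂u/∂y) / 2`. -/
def wirtingerZbar (u : ℂ → ℂ) (z : ℂ) : ℂ :=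
  (fderiv ℝ u z 1 + Complex.I * fderiv ℝ u z Complex.I) / 2

/-- The coefficient `∂²u/∂z∂z̄` of the `(1,1)`-form `∂∂̄u = (∂²u/∂z∂z̄) dz ∧ dz̄`. -/
def ddbarCoeff (u : ℂ → ℂ) : ℂ → ℂ := wirtingerZ (wirtingerZbar u)

/-- The coefficient of `dz ∧ dz̄` in the hyperbolic metric `μ^hyp = (i/2) dz ∧ dz̄ / y^2`. -/
def hypMetricCoeff (z : ℍ) : ℂ := Complex.I / 2 / ((z.im : ℝ) : ℂ) ^ 2

/-- The coefficient of `dz ∧ dz̄` in the Bergman metric `-(i/2π) ∂∂̄ log B`, pulled back to `ℍ`,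
that is, in the local coordinate `z` of `X`, where `B` is the Bergman kernel. -/
def bergmanMetricCoeff {Γ : Subgroup PSL(2, ℝ)} {k n : ℕ}
    (ω : Fin n → kDifferentials Γ k) (z : ℍ) : ℂ :=
  -(Complex.I / (2 * (Real.pi : ℂ))) *
    ddbarCoeff (fun w : ℂ => ((Real.log (bergmanKernel ω (proj Γ (ofComplex w))) : ℝ) : ℂ)) z

/-- The constant `C_{X,k}` as a function of `k` and the injectivity radius `r = r_X`; it is used
for `k ≥ 3` only, so that the exponents are not truncated. -/
def constC (r : ℝ) (k : ℕ) : ℝ :=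
  (2 * k - 1) / (4 * Real.pi) *
      (2 + 16 / Real.cosh (r / 4) ^ (2 * k - 4) + 8 / Real.cosh (r / 2) ^ (2 * k - 3)) +
    (2 * k - 1) / (2 * Real.pi * Real.sinh (r / 4) ^ 2) *
      (1 / ((2 * k - 2) * Real.cosh (r / 2) ^ (2 * k - 3)) +
        1 / ((k - 2) * Real.cosh (r / 2) ^ (2 * k - 4)))

end HypSurface

end

/-!
The curvature form of the weight-`k` Bergman metric is bounded without Poincaré series, by two
local estimates on embedded discs.

Near a point `z₀ = x₀ + i y₀` write `B = y^(2k) ‖V‖²`, where `V` is the vector of the coefficient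
functions of the orthonormal basis. Since `∂∂̄ log y = -1 / (4 y²)`, the quotient of the two
metrics is `k / (2π) - (y₀² / π) Q`, where `Q = ∂²/∂z∂z̄ log ‖V‖²` is nonnegative by the
Cauchy-Schwarz inequality (`ddbarCoeff_logWeighted`, `leviForm_nonneg`). So everything rests on an
upper bound for `y₀² Q`.

* The disc of hyperbolic radius `r_X / 2` about `z₀` injects into `X`, and the mean value
  inequality for `f(w) (w - conj z₀)^(2k-2)` bounds `y₀^(2k) |f(z₀)|²` by a constant `M` times the
  squared `L²` norm of `f` (`hypNorm_sq_le`). Applied to the extremal differential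
  `∑ conj (f_i(z₀)) f_i` this gives `B ≤ M` on all of `X` (`bergmanKernel_le`). Integration of this
  bound over a fundamental domain, which has finite area, shows that orthonormal families have
  bounded length, hence the finite dimension and the existence of an orthonormal basis
  (`exists_l2Orthonormal_basis`).
* `Q` does not change when `V` is multiplied by the nonvanishing holomorphic function
  `(w - conj z₀)^(2k)`. The norm squared of the product is `B` up to an explicit factor, so `B ≤ M`
  and Cauchy's estimate on a disc of Cayley radius `1 / (2 √k)` bound `y₀² Q` by a multiple of
  `k M / B` (`leviForm_le_of_weighted_norm_le`).

Finally, with a suitable radius in the mean value inequality, this bound is at most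
`5 k² C_{X,k} / B` (`exists_meanConst_le_constC`), because `C_{X,k}` is at least
`(2k - 1) / (2π)`, and of order at least `1 / tanh² (r_X / 4)` when `r_X` is small. The positivity
of `r_X` comes from proper discontinuity, cocompactness and the absence of torsion
(`IsSurfaceGroup.injRadius_pos`).
-/

namespace HypSurface

/-! ### The action of a surface group on the upper half-plane -/

open scoped Pointwise

variable {Γ : Subgroup PSL(2, ℝ)}

instance : IsIsometricSMul PSL(2, ℝ) ℍ where
  isometry_smul γ := by
    obtain ⟨g, rfl⟩ := QuotientGroup.mk_surjective γ
    have h : (fun z : ℍ => (QuotientGroup.mk g : PSL(2, ℝ)) • z) = fun z => g • z :=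
      funext (psl_mk_smul g)
    rw [h]
    exact isometry_smul ℍ g

instance : IsIsometricSMul Γ ℍ where
  isometry_smul γ := isometry_smul ℍ (γ : PSL(2, ℝ))

instance : SMulInvariantMeasure PSL(2, ℝ) ℍ volume where
  measure_preimage_smul γ s hs := by
    obtain ⟨g, rfl⟩ := QuotientGroup.mk_surjective γ
    have h : (fun z : ℍ => (QuotientGroup.mk g : PSL(2, ℝ)) • z)
        = fun z => (Matrix.SpecialLinearGroup.mapGL ℝ g : GL (Fin 2) ℝ) • z := by
      funext z
      rw [psl_mk_smul, MulAction.compHom_smul_def]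
    rw [h]
    exact measure_preimage_smul volume _ s

instance : SMulInvariantMeasure Γ ℍ volume where
  measure_preimage_smul γ s _ := measure_preimage_smul volume (γ : PSL(2, ℝ)) s

/-- The preimage of a discrete subgroup of `PSL(2, ℝ)` in `SL(2, ℝ)` is discrete, since the
kernel `{±1}` is finite. -/
theorem discreteTopology_comap (hΓ : DiscreteTopology Γ) :
    DiscreteTopology (Γ.comap (QuotientGroup.mk' (Subgroup.center SL(2, ℝ)))) := by
  set π := QuotientGroup.mk' (Subgroup.center SL(2, ℝ))
  obtain ⟨U, hU, hU1⟩ := isOpen_induced_iff.1 (isOpen_discrete ({1} : Set Γ))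
  have hcont : Continuous π := QuotientGroup.continuous_mk
  have hopen : IsOpen ((fun g : Γ.comap π => π g) ⁻¹' U) :=
    hU.preimage (hcont.comp continuous_subtype_val)
  have hfin : ((fun g : Γ.comap π => π g) ⁻¹' U).Finite := by
    refine Set.Finite.of_finite_image (f := fun g => (g : SL(2, ℝ)))
      (Set.Finite.subset (Set.toFinite ({1, -1} : Set SL(2, ℝ))) ?_)
      Subtype.val_injective.injOn
    rintro _ ⟨⟨g, hg⟩, hgU, rfl⟩
    have h1 : (⟨π g, hg⟩ : Γ) = 1 := by
      have : (⟨π g, hg⟩ : Γ) ∈ Subtype.val ⁻¹' U := hgU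
      rwa [hU1] at this
    have h2 : g ∈ Subgroup.center SL(2, ℝ) :=
      (QuotientGroup.eq_one_iff g).1 (congrArg Subtype.val h1)
    obtain ⟨r, hr, hr'⟩ := Matrix.SpecialLinearGroup.mem_center_iff.1 h2
    rw [Fintype.card_fin] at hr
    rcases sq_eq_sq_iff_eq_or_eq_neg.1 (hr.trans (one_pow 2).symm) with h | h
    · left
      ext i j
      simp [← hr', h]
    · right
      ext i j
      fin_cases i <;> fin_cases j <;> simp [← hr', h]
  refine discreteTopology_of_isOpen_singleton_one ?_
  have h : ({1} : Set (Γ.comap π)) = ((fun g : Γ.comap π => π g) ⁻¹' U) \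
      (((fun g : Γ.comap π => π g) ⁻¹' U) \ {1}) := by
    have : (1 : Γ) ∈ Subtype.val ⁻¹' U := by rw [hU1]; rfl
    ext g
    simp only [Set.mem_singleton_iff, Set.mem_sdiff, Set.mem_preimage, not_and, not_not]
    constructor
    · rintro rfl
      exact ⟨by simpa using this, fun _ => rfl⟩
    · exact fun ⟨h1, h2⟩ => h2 h1
  rw [h]
  exact hopen.sdiff (hfin.sdiff).isClosed

/-- A discrete subgroup of `PSL(2, ℝ)` acts properly discontinuously on `ℍ`, because its preimage
in `SL(2, ℝ)` does. -/
theorem properlyDiscontinuousSMul (hΓ : DiscreteTopology Γ) : ProperlyDiscontinuousSMul Γ ℍ where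
  finite_disjoint_inter_image {K L} hK hL := by
    set π := QuotientGroup.mk' (Subgroup.center SL(2, ℝ))
    have : DiscreteTopology (Γ.comap π) := discreteTopology_comap hΓ
    refine ((ProperlyDiscontinuousSMul.finite_disjoint_inter_image (Γ := Γ.comap π) hK hL).image
      (fun g : Γ.comap π => (⟨π g, g.2⟩ : Γ))).subset ?_
    rintro ⟨γ, hγ⟩ ⟨w, ⟨z, hz, hzw⟩, hw⟩
    obtain ⟨g, rfl⟩ := QuotientGroup.mk_surjective γ
    exact ⟨⟨g, hγ⟩, ⟨w, ⟨z, hz, (psl_mk_smul g z).symm.trans hzw⟩, hw⟩, rfl⟩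

theorem countable_of_discrete (hΓ : DiscreteTopology Γ) : Countable Γ := by
  have := properlyDiscontinuousSMul hΓ
  rw [← Set.countable_univ_iff]
  refine (Set.countable_iUnion fun n : ℕ =>
    (ProperlyDiscontinuousSMul.finite_disjoint_inter_image (Γ := Γ)
      (isCompact_singleton (x := I)) (isCompact_closedBall I (n : ℝ))).countable).mono ?_
  intro γ _
  obtain ⟨n, hn⟩ := exists_nat_ge (dist (γ • I) I)
  exact Set.mem_iUnion.2 ⟨n, γ • I, ⟨I, rfl, rfl⟩, Metric.mem_closedBall.2 hn⟩

namespace IsSurfaceGroup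

theorem smul_ne_self (hΓ : IsSurfaceGroup Γ) {γ : PSL(2, ℝ)} (hγ : γ ∈ Γ) (h1 : γ ≠ 1) (z : ℍ) :
    γ • z ≠ z := by
  intro hz
  have := properlyDiscontinuousSMul hΓ.discrete
  have hfin := ProperlyDiscontinuousSMul.finite_stabilizer' Γ z
  refine hΓ.torsionFree γ hγ h1 ?_
  have hpow : ∀ n : ℕ, γ ^ n • z = z := fun n => by
    induction n with
    | zero => simp
    | succ n ih => rw [pow_succ, mul_smul, hz, ih]
  have hsub : Set.range (fun n : ℕ => γ ^ n) ⊆ Subtype.val '' {γ : Γ | γ • z = z} := by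
    rintro _ ⟨n, rfl⟩
    exact ⟨⟨γ ^ n, Γ.pow_mem hγ n⟩, hpow n, rfl⟩
  have hninj : ¬ Function.Injective (fun n : ℕ => γ ^ n) := fun hinj =>
    Set.infinite_range_of_injective hinj ((hfin.image _).subset hsub)
  rwa [injective_pow_iff_not_isOfFinOrder, not_not] at hninj

/-- A compact subset of `ℍ` that meets every orbit. -/
theorem exists_compact_cover (hΓ : IsSurfaceGroup Γ) :
    ∃ K : Set ℍ, IsCompact K ∧ ∀ z : ℍ, ∃ γ : Γ, γ • z ∈ K := by
  have := hΓ.cocompact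
  have hopen : IsOpenMap (Quotient.mk (MulAction.orbitRel Γ ℍ)) :=
    isOpenMap_quotient_mk'_mul
  obtain ⟨t, ht⟩ := isCompact_univ.elim_finite_subcover
    (fun n : ℕ => Quotient.mk (MulAction.orbitRel Γ ℍ) '' Metric.ball I (n : ℝ))
    (fun n => hopen _ Metric.isOpen_ball) (by
      intro x _
      obtain ⟨z, rfl⟩ := Quotient.exists_rep x
      obtain ⟨n, hn⟩ := exists_nat_gt (dist z I)
      exact Set.mem_iUnion.2 ⟨n, z, hn, rfl⟩)
  refine ⟨⋃ n ∈ t, Metric.closedBall I (n : ℝ),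
    t.isCompact_biUnion fun n _ => isCompact_closedBall _ _, fun z => ?_⟩
  obtain ⟨n, hn, w, hw, hwz⟩ : ∃ n ∈ t, ∃ w ∈ Metric.ball I (n : ℝ),
      Quotient.mk (MulAction.orbitRel Γ ℍ) w = Quotient.mk (MulAction.orbitRel Γ ℍ) z := by
    simpa using ht (Set.mem_univ (Quotient.mk (MulAction.orbitRel Γ ℍ) z))
  obtain ⟨γ, rfl⟩ : (MulAction.orbitRel Γ ℍ) w z := Quotient.exact hwz
  exact ⟨γ, Set.mem_biUnion hn (Metric.ball_subset_closedBall hw)⟩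

theorem exists_ne_one (hΓ : IsSurfaceGroup Γ) : ∃ γ ∈ Γ, γ ≠ 1 := by
  by_contra! h
  obtain ⟨K, hK, hcov⟩ := hΓ.exists_compact_cover
  refine noncompact_univ ℍ (hK.of_isClosed_subset isClosed_univ fun z _ => ?_)
  obtain ⟨⟨γ, hγ⟩, hz⟩ := hcov z
  have : γ • z ∈ K := hz
  rwa [h γ hγ, one_smul] at this

/-- Displacements are bounded below: by conjugation it is enough to move points of a compact set,
and only finitely many elements move such a point by less than `1`. -/
theorem exists_le_dist_smul (hΓ : IsSurfaceGroup Γ) :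
    ∃ ε > 0, ∀ z : ℍ, ∀ γ ∈ Γ, γ ≠ 1 → ε ≤ dist z (γ • z) := by
  have := properlyDiscontinuousSMul hΓ.discrete
  obtain ⟨K, hK, hcov⟩ := hΓ.exists_compact_cover
  have hfin := ProperlyDiscontinuousSMul.finite_disjoint_inter_image (Γ := Γ) hK
    (hK.cthickening (r := 1))
  have hpos : ∀ γ : Γ, γ ≠ 1 → ∃ ε > 0, ∀ z ∈ K, ε ≤ dist z (γ • z) := by
    intro γ hγ
    rcases K.eq_empty_or_nonempty with rfl | hne
    · exact ⟨1, one_pos, by simp⟩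
    obtain ⟨z, _, hz⟩ := hK.exists_isMinOn (f := fun z : ℍ => dist z (γ • z)) hne
      (continuous_id.dist (continuous_const_smul γ)).continuousOn
    refine ⟨dist z (γ • z), dist_pos.2 fun h => ?_, fun w hw => hz hw⟩
    exact hΓ.smul_ne_self γ.2 (fun h' => hγ (Subtype.ext h')) z h.symm
  choose! e he hle using hpos
  obtain ⟨ε, hε, hε'⟩ : ∃ ε > 0, ∀ γ ∈ hfin.toFinset, γ ≠ 1 → ε ≤ e γ := by
    classical
    induction hfin.toFinset using Finset.induction_on with
    | empty => exact ⟨1, one_pos, by simp⟩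
    | insert a s _ ih =>
      obtain ⟨ε, hε, h⟩ := ih
      by_cases ha : a = 1
      · exact ⟨ε, hε, fun γ hγ h1 => h γ ((Finset.mem_insert.1 hγ).resolve_left (ha ▸ h1)) h1⟩
      · refine ⟨min ε (e a), lt_min hε (he a ha), fun γ hγ h1 => ?_⟩
        rcases Finset.mem_insert.1 hγ with rfl | hγ
        · exact min_le_right _ _
        · exact (min_le_left _ _).trans (h γ hγ h1)
  refine ⟨min 1 ε, lt_min one_pos hε, fun z γ hγ h1 => ?_⟩
  obtain ⟨g, hg⟩ := hcov z
  set γ' : Γ := g * ⟨γ, hγ⟩ * g⁻¹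
  have hγ' : γ' ≠ 1 := fun h => h1 (congrArg Subtype.val (conj_eq_one_iff.1 h))
  have hd : dist z (γ • z) = dist (g • z) (γ' • g • z) := by
    rw [smul_smul, inv_mul_cancel_right, mul_smul, dist_smul]
    rfl
  rw [hd]
  by_cases hlt : dist (g • z) (γ' • g • z) ≤ 1
  · refine (min_le_right _ _).trans ((hε' γ' ?_ hγ').trans (hle γ' hγ' _ hg))
    refine hfin.mem_toFinset.2 ⟨γ' • g • z, ⟨g • z, hg, rfl⟩, ?_⟩
    exact Metric.mem_cthickening_of_dist_le _ _ _ _ hg (by rwa [dist_comm])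
  · exact (min_le_left _ _).trans (le_of_not_ge hlt)

theorem injRadius_pos (hΓ : IsSurfaceGroup Γ) : 0 < injRadius Γ := by
  obtain ⟨ε, hε, h⟩ := hΓ.exists_le_dist_smul
  obtain ⟨γ, hγ, h1⟩ := hΓ.exists_ne_one
  refine hε.trans_le (le_csInf ⟨_, I, γ, hγ, h1, rfl⟩ ?_)
  rintro _ ⟨z, γ, hγ, h1, rfl⟩
  exact h z γ hγ h1

end IsSurfaceGroup

theorem injRadius_le_dist {γ : PSL(2, ℝ)} (hγ : γ ∈ Γ) (h1 : γ ≠ 1) (z : ℍ) :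
    injRadius Γ ≤ dist z (γ • z) := by
  refine csInf_le ⟨0, ?_⟩ ⟨z, γ, hγ, h1, rfl⟩
  rintro _ ⟨w, δ, _, _, rfl⟩
  exact dist_nonneg

/-- A subset of a ball of radius `r_X / 2` injects into `X`, so integrals over it are at most
integrals over a fundamental domain. -/
theorem setLIntegral_le_of_dist_lt [Countable Γ] {F : Set ℍ}
    (hF : IsFundamentalDomain Γ F (volume : Measure ℍ)) {φ : ℍ → ENNReal}
    (hφ : ∀ (γ : Γ) (z : ℍ), φ (γ • z) = φ z) {D : Set ℍ} (hD : MeasurableSet D) {z₀ : ℍ}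
    (hDz : ∀ z ∈ D, dist z z₀ < injRadius Γ / 2) :
    ∫⁻ z in D, φ z ≤ ∫⁻ z in F, φ z := by
  rw [hF.setLIntegral_eq_tsum']
  simp_rw [hφ]
  have hmeas : ∀ γ : Γ, MeasurableSet (γ • D) := fun γ => hD.const_smul γ
  have hdisj : Pairwise (Function.onFun Disjoint fun γ : Γ => γ • D) := by
    intro γ₁ γ₂ hne
    refine Set.disjoint_left.2 ?_
    rintro _ ⟨z, hz, rfl⟩ ⟨w, hw, hzw⟩
    have hzw' : (γ₂⁻¹ * γ₁) • z = w := by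
      rw [mul_smul]
      exact inv_smul_eq_iff.2 hzw.symm
    have h1 : ((γ₂⁻¹ * γ₁ : Γ) : PSL(2, ℝ)) ≠ 1 := fun h =>
      hne (inv_mul_eq_one.1 (Subtype.ext h)).symm
    have h2 : injRadius Γ ≤ dist z w := by
      rw [← hzw']
      exact injRadius_le_dist (γ₂⁻¹ * γ₁).2 h1 z
    have := dist_triangle_right z w z₀
    linarith [hDz z hz, hDz w hw]
  have hrw : ∀ γ : Γ, (volume : Measure ℍ).restrict (γ • D ∩ F)
      = (volume.restrict F).restrict (γ • D) := fun γ => (Measure.restrict_restrict (hmeas γ)).symm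
  simp_rw [hrw]
  rw [← lintegral_iUnion hmeas hdisj]
  exact setLIntegral_le_lintegral _ _

/-- A fundamental domain of a surface group has finite area, because the translates of a compact
set cover `ℍ`. -/
theorem IsSurfaceGroup.volume_lt_top (hΓ : IsSurfaceGroup Γ) {F : Set ℍ}
    (hF : IsFundamentalDomain Γ F (volume : Measure ℍ)) : volume F < ⊤ := by
  have := countable_of_discrete hΓ.discrete
  obtain ⟨K, hK, hcov⟩ := hΓ.exists_compact_cover
  have hF' : F = ⋃ γ : Γ, (γ • K ∩ F) := by
    rw [← Set.iUnion_inter, eq_comm, Set.inter_eq_right]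
    intro z _
    obtain ⟨γ, hγ⟩ := hcov z
    exact Set.mem_iUnion.2 ⟨γ⁻¹, Set.mem_inv_smul_set_iff.2 hγ⟩
  calc volume F ≤ ∑' γ : Γ, volume (γ • K ∩ F) := by
        conv_lhs => rw [hF']
        exact measure_iUnion_le _
    _ = volume K := (hF.measure_eq_tsum K).symm
    _ < ⊤ := hK.measure_lt_top

end HypSurface

namespace HypSurface

/-! ### The mean value inequality on hyperbolic discs -/

/-- The mean value property over a disc, from the mean value property over circles in polar
coordinates. -/
theorem setIntegral_ball_of_differentiableOn {g : ℂ → ℂ} {c : ℂ} {ρ : ℝ} (hρ : 0 < ρ)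
    (hg : DifferentiableOn ℂ g (Metric.ball c ρ)) (hint : IntegrableOn g (Metric.ball c ρ)) :
    ∫ w in Metric.ball c ρ, g w = (Real.pi * ρ ^ 2 : ℝ) • g c := by
  set G : ℂ → ℂ := (Metric.ball (0 : ℂ) ρ).indicator fun w => g (c + w) with hG
  have hmp : MeasurePreserving (fun w : ℂ => c + w) := measurePreserving_add_left volume c
  have hpre : (fun w : ℂ => c + w) ⁻¹' Metric.ball c ρ = Metric.ball 0 ρ := by
    ext w; simp
  have hGint : Integrable G := by
    rw [hG, integrable_indicator_iff Metric.isOpen_ball.measurableSet, ← hpre]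
    exact (hmp.integrableOn_comp_preimage (measurableEmbedding_addLeft c)).2 hint
  have h1 : ∫ w in Metric.ball c ρ, g w = ∫ w, G w := by
    rw [hG, integral_indicator Metric.isOpen_ball.measurableSet, ← hpre]
    exact (hmp.setIntegral_preimage_emb (measurableEmbedding_addLeft c) _ _).symm
  have hpolar : IntegrableOn (fun p : ℝ × ℝ => p.1 • G (Complex.polarCoord.symm p))
      (Set.Ioi (0 : ℝ) ×ˢ Set.Ioo (-Real.pi) Real.pi) := by
    have hcont : Continuous fun p : ℝ × ℝ => Complex.polarCoord.symm p := by
      simp only [Complex.polarCoord_symm_apply]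
      fun_prop
    have hGm : Measurable G := by
      classical
      rw [hG, ← Set.piecewise_eq_indicator]
      refine ContinuousOn.measurable_piecewise ?_ continuousOn_const
        Metric.isOpen_ball.measurableSet
      exact hg.continuousOn.comp (by fun_prop) fun w hw => by simpa using hw
    refine ⟨(measurable_fst.smul (hGm.comp hcont.measurable)).aestronglyMeasurable, ?_⟩
    refine lt_of_eq_of_lt ?_ hGint.2
    rw [← Complex.lintegral_comp_polarCoord_symm]
    refine setLIntegral_congr_fun (measurableSet_Ioi.prod measurableSet_Ioo) fun p hp => ?_
    rw [enorm_smul, Real.enorm_of_nonneg (le_of_lt hp.1), smul_eq_mul]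
  have hcircle : ∀ r ∈ Set.Ioi (0 : ℝ),
      ∫ θ in Set.Ioo (-Real.pi) Real.pi, r • G (Complex.polarCoord.symm (r, θ))
        = (Set.Ioo 0 ρ).indicator (fun r => (2 * Real.pi * r) • g c) r := by
    intro r hr
    have hr0 : 0 < r := hr
    have hn : ∀ θ, ‖Complex.polarCoord.symm (r, θ)‖ = r := fun θ => by
      rw [Complex.norm_polarCoord_symm, abs_of_pos hr0]
    by_cases hrρ : r < ρ
    · rw [Set.indicator_of_mem (Set.mem_Ioo.2 ⟨hr0, hrρ⟩), integral_smul]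
      have hval : ∀ θ, G (Complex.polarCoord.symm (r, θ)) = g (circleMap c r θ) := fun θ => by
        rw [hG, Set.indicator_of_mem (by rw [mem_ball_zero_iff, hn]; exact hrρ)]
        rw [Complex.polarCoord_symm_apply, circleMap, Complex.exp_mul_I]
        push_cast
        rfl
      simp_rw [hval]
      have havg : Real.circleAverage g c r = g c := by
        refine DiffContOnCl.circleAverage ?_
        rw [abs_of_pos hr0]
        exact (hg.mono (Metric.closedBall_subset_ball hrρ)).diffContOnCl_ball subset_rfl
      have hper : ∫ θ in Set.Ioo (-Real.pi) Real.pi, g (circleMap c r θ)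
          = ∫ θ in (0 : ℝ)..2 * Real.pi, g (circleMap c r θ) := by
        rw [← integral_Ioc_eq_integral_Ioo, ← intervalIntegral.integral_of_le (by
          linarith [Real.pi_pos])]
        have := ((periodic_circleMap c r).comp g).intervalIntegral_add_eq (-Real.pi) 0
        simpa [two_mul, Function.comp_def] using this
      rw [Real.circleAverage, ← hper, inv_smul_eq_iff₀ (by positivity)] at havg
      rw [havg, smul_smul]
      ring_nf
    · rw [Set.indicator_of_notMem (fun h => hrρ h.2)]
      have hval : ∀ θ, G (Complex.polarCoord.symm (r, θ)) = 0 := fun θ => by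
        rw [hG, Set.indicator_of_notMem (by rw [mem_ball_zero_iff, hn]; exact hrρ)]
      simp only [hval, smul_zero, integral_zero]
  rw [h1, ← Complex.integral_comp_polarCoord_symm, polarCoord_target,
    Measure.volume_eq_prod, setIntegral_prod _ hpolar,
    setIntegral_congr_fun measurableSet_Ioi hcircle, setIntegral_indicator measurableSet_Ioo,
    Set.inter_eq_self_of_subset_right Set.Ioo_subset_Ioi_self, integral_smul_const,
    ← integral_Ioc_eq_integral_Ioo, ← intervalIntegral.integral_of_le hρ.le,
    intervalIntegral.integral_const_mul, integral_id]
  congr 1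
  ring

/-- The mean value property of `g²` gives the mean value inequality for `|g|²`. -/
theorem le_setLIntegral_ball_normSq {g : ℂ → ℂ} {c : ℂ} {ρ : ℝ} (hρ : 0 < ρ)
    (hg : DifferentiableOn ℂ g (Metric.ball c ρ)) (hc : ContinuousOn g (Metric.closedBall c ρ)) :
    ENNReal.ofReal (Real.pi * ρ ^ 2 * ‖g c‖ ^ 2)
      ≤ ∫⁻ w in Metric.ball c ρ, ENNReal.ofReal (‖g w‖ ^ 2) := by
  have hint : IntegrableOn (fun w => g w ^ 2) (Metric.ball c ρ) :=
    ((hc.pow 2).integrableOn_compact (isCompact_closedBall c ρ)).mono_set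
      Metric.ball_subset_closedBall
  have h := setIntegral_ball_of_differentiableOn (g := fun w => g w ^ 2) hρ (hg.pow 2) hint
  have hn := norm_integral_le_integral_norm (μ := volume.restrict (Metric.ball c ρ))
    (fun w => g w ^ 2)
  rw [h, norm_smul, norm_pow, Real.norm_of_nonneg (by positivity)] at hn
  simp only [norm_pow] at hn
  have hint' : IntegrableOn (fun w => ‖g w‖ ^ 2) (Metric.ball c ρ) := by
    simpa [norm_pow, IntegrableOn] using hint.norm
  rw [← ofReal_integral_eq_lintegral_ofReal hint' (Filter.Eventually.of_forall fun w => by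
    positivity)]
  exact ENNReal.ofReal_le_ofReal hn

section disc

variable {z₀ : ℍ} {w : ℂ} {R : ℝ}

theorem two_mul_im_le_norm_add (w : ℂ) :
    2 * z₀.im ≤ ‖w - conj (z₀ : ℂ)‖ + ‖w - z₀‖ := by
  have h1 : ‖(z₀ : ℂ) - conj (z₀ : ℂ)‖ = 2 * z₀.im := by
    rw [Complex.sub_conj]
    simp [abs_of_pos z₀.im_pos]
  rw [← h1, ← norm_sub_rev (z₀ : ℂ) w, add_comm]
  refine (norm_add_le _ _).trans' (le_of_eq ?_)
  congr 1; ring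

/-- The Euclidean disc of radius `2 R / (1 + R) * Im z₀` about `z₀` is contained in the hyperbolic
disc of Euclidean radius `R` in the Cayley coordinate `(w - z₀) / (w - conj z₀)`. -/
theorem norm_sub_le_mul_norm_sub_conj (hR : 0 < R)
    (hw : ‖w - z₀‖ ≤ 2 * R / (1 + R) * z₀.im) :
    ‖w - z₀‖ ≤ R * ‖w - conj (z₀ : ℂ)‖ := by
  have h2 := two_mul_im_le_norm_add (z₀ := z₀) w
  rw [div_mul_eq_mul_div, le_div_iff₀ (by positivity)] at hw
  nlinarith

theorem im_pos_of_norm_sub_le (hR : 0 < R) (hR1 : R < 1)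
    (hw : ‖w - z₀‖ ≤ 2 * R / (1 + R) * z₀.im) : 0 < w.im := by
  have h1 : |w.im - z₀.im| ≤ ‖w - z₀‖ := by
    simpa using Complex.abs_im_le_norm (w - z₀)
  have h2 : 2 * R / (1 + R) * z₀.im < z₀.im := by
    have : 2 * R / (1 + R) < 1 := by
      rw [div_lt_one (by positivity)]
      linarith
    nlinarith [z₀.im_pos]
  have := neg_abs_le (w.im - z₀.im)
  linarith

theorem normSq_sub_conj_eq (w : ℂ) :
    ‖w - conj (z₀ : ℂ)‖ ^ 2 = ‖w - z₀‖ ^ 2 + 4 * w.im * z₀.im := by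
  rw [← Complex.normSq_eq_norm_sq, ← Complex.normSq_eq_norm_sq, Complex.normSq_apply,
    Complex.normSq_apply]
  simp
  ring

/-- This is `4 Im w Im z₀ / |w - conj z₀|² = 1 - |u|²` for the Cayley coordinate `u` of `w`. -/
theorem mul_normSq_sub_conj_le (hR : 0 < R)
    (hw : ‖w - z₀‖ ≤ 2 * R / (1 + R) * z₀.im) :
    (1 - R ^ 2) * ‖w - conj (z₀ : ℂ)‖ ^ 2 ≤ 4 * w.im * z₀.im := by
  have h := pow_le_pow_left₀ (norm_nonneg _) (norm_sub_le_mul_norm_sub_conj hR hw) 2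
  have := normSq_sub_conj_eq (z₀ := z₀) w
  rw [mul_pow] at h
  linarith

theorem tanh_pos {x : ℝ} (hx : 0 < x) : 0 < Real.tanh x := by
  rw [Real.tanh_eq_sinh_div_cosh]
  exact div_pos (Real.sinh_pos_iff.2 hx) (Real.cosh_pos _)

theorem dist_lt_of_norm_sub_lt {w : ℍ} {r : ℝ} (hR : 0 < R) (hRr : R ≤ Real.tanh (r / 2))
    (hw : ‖(w : ℂ) - z₀‖ < 2 * R / (1 + R) * z₀.im) : dist w z₀ < r := by
  have h2 := two_mul_im_le_norm_add (z₀ := z₀) w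
  rw [div_mul_eq_mul_div, lt_div_iff₀ (by positivity)] at hw
  have h3 : ‖(w : ℂ) - z₀‖ < R * ‖(w : ℂ) - conj (z₀ : ℂ)‖ := by nlinarith
  have hpos : 0 < ‖(w : ℂ) - conj (z₀ : ℂ)‖ :=
    pos_of_mul_pos_right ((norm_nonneg _).trans_lt h3) hR.le
  have h4 : Real.tanh (dist w z₀ / 2) < Real.tanh (r / 2) := by
    rw [UpperHalfPlane.tanh_half_dist, Complex.dist_eq, Complex.dist_eq, div_lt_iff₀ hpos]
    exact h3.trans_le (mul_le_mul_of_nonneg_right hRr hpos.le)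
  have := Real.strictMonoOn_artanh ⟨Real.neg_one_lt_tanh _, Real.tanh_lt_one _⟩
    ⟨Real.neg_one_lt_tanh _, Real.tanh_lt_one _⟩ h4
  rw [Real.artanh_tanh, Real.artanh_tanh] at this
  linarith

end disc

/-- A lower bound for the `L²` mass of `y^k |f|` on a disc. With the Cayley coordinate `u`, the
weight `y^(2k-2) = ((1 - |u|²) |w - conj z₀|² / (4 y₀))^(2k-2)` reduces this to the mean value
inequality for `f(w) (w - conj z₀)^(2k-2)`. -/
theorem le_setLIntegral_disc {f : ℍ → ℂ} (hf : MDifferentiable 𝓘(ℂ) 𝓘(ℂ) f) {k : ℕ} (hk : 1 ≤ k)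
    (z₀ : ℍ) {R : ℝ} (hR : 0 < R) (hR1 : R < 1) :
    ENNReal.ofReal (Real.pi * (2 * R / (1 + R)) ^ 2 * (1 - R ^ 2) ^ (2 * k - 2) *
        (z₀.im ^ k * ‖f z₀‖) ^ 2) ≤
      ∫⁻ z in {z : ℍ | ‖(z : ℂ) - z₀‖ < 2 * R / (1 + R) * z₀.im},
        ENNReal.ofReal ((z.im ^ k * ‖f z‖) ^ 2) := by
  set δ := 2 * R / (1 + R) with hδ
  have hδ0 : 0 < δ := by positivity
  have hy := z₀.im_pos
  obtain ⟨m, rfl⟩ : ∃ m, k = m + 1 := ⟨k - 1, by omega⟩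
  have hm : 2 * (m + 1) - 2 = 2 * m := by omega
  rw [hm]
  set D : Set ℍ := {z : ℍ | ‖(z : ℂ) - z₀‖ < δ * z₀.im}
  set c : ℂ := conj (z₀ : ℂ)
  set F : ℂ → ℂ := f ∘ ofComplex
  set g : ℂ → ℂ := fun w => F w * (w - c) ^ (2 * m)
  have hF := UpperHalfPlane.mdifferentiable_iff.1 hf
  have hsub : Metric.closedBall (z₀ : ℂ) (δ * z₀.im) ⊆ {z : ℂ | 0 < z.im} := fun w hw =>
    im_pos_of_norm_sub_le hR hR1 (by simpa [dist_eq_norm] using hw)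
  have hg : DifferentiableOn ℂ g {z : ℂ | 0 < z.im} :=
    hF.mul (by fun_prop)
  have hmean := le_setLIntegral_ball_normSq (mul_pos hδ0 hy)
    (hg.mono (Metric.ball_subset_closedBall.trans hsub)) (hg.continuousOn.mono hsub)
  set A : ℝ := ((1 - R ^ 2) / (4 * z₀.im)) ^ (2 * m)
  have hA : 0 ≤ A := by
    have : 0 ≤ 1 - R ^ 2 := by nlinarith
    positivity
  have hD : MeasurableSet D := by
    refine (isOpen_lt ?_ continuous_const).measurableSet
    fun_prop
  have himage : UpperHalfPlane.coe '' D = Metric.ball (z₀ : ℂ) (δ * z₀.im) := by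
    ext w
    constructor
    · rintro ⟨z, hz, rfl⟩
      rw [Metric.mem_ball, dist_eq_norm]
      exact hz
    · intro hw
      exact ⟨⟨w, hsub (Metric.ball_subset_closedBall hw)⟩, by simpa [D, dist_eq_norm] using hw, rfl⟩
  have hlint : ∫⁻ z in D, ENNReal.ofReal ((z.im ^ (m + 1) * ‖f z‖) ^ 2)
      = ∫⁻ w in Metric.ball (z₀ : ℂ) (δ * z₀.im),
          ENNReal.ofReal (w.im ^ (2 * m) * ‖F w‖ ^ 2) := by
    have hfm : Measurable fun z : ℍ => ENNReal.ofReal ((z.im ^ (m + 1) * ‖f z‖) ^ 2) := by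
      have := hf.continuous
      refine (ENNReal.continuous_ofReal.comp ?_).measurable
      fun_prop
    have hmp : MeasurePreserving UpperHalfPlane.coe (volume.comap UpperHalfPlane.coe)
        (volume.restrict (.range UpperHalfPlane.coe)) :=
      ⟨measurable_coe, by rw [measurableEmbedding_coe.map_comap]⟩
    have hdens : Measurable fun z : ℍ =>
        ((((1 / NNReal.mk z.im z.im_pos.le : NNReal) ^ 2 : NNReal)) : ENNReal) := by
      refine (measurable_const.div ?_).pow_const 2 |>.coe_nnreal_ennreal
      exact (UpperHalfPlane.continuous_im.subtype_mk _).measurable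
    have hball : Metric.ball (z₀ : ℂ) (δ * z₀.im)
        = UpperHalfPlane.coe '' D ∩ .range UpperHalfPlane.coe := by
      rw [Set.inter_eq_self_of_subset_left (Set.image_subset_range _ _), himage]
    rw [UpperHalfPlane.volume_def, setLIntegral_withDensity_eq_setLIntegral_mul _ hdens hfm hD,
      hball,
      ← Measure.restrict_restrict' measurableEmbedding_coe.measurableSet_range,
      ← hmp.setLIntegral_comp_emb measurableEmbedding_coe]
    refine setLIntegral_congr_fun hD fun z _ => ?_
    have hz := z.im_pos
    simp only [Pi.mul_apply, F, Function.comp_apply, ofComplex_apply, coe_im]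
    rw [← ENNReal.ofReal_coe_nnreal, ← ENNReal.ofReal_mul NNReal.zero_le_coe]
    congr 1
    push_cast
    field_simp
    ring
  rw [hlint]
  calc _ = ENNReal.ofReal A * ENNReal.ofReal (Real.pi * (δ * z₀.im) ^ 2 * ‖g z₀‖ ^ 2) := by
        rw [← ENNReal.ofReal_mul hA]
        congr 1
        have h1 : ‖(z₀ : ℂ) - c‖ = 2 * z₀.im := by
          simp only [c]
          rw [Complex.sub_conj]
          simp [abs_of_pos z₀.im_pos]
        simp only [g, A, F, norm_mul, norm_pow, h1, Function.comp_apply, ofComplex_apply, div_pow]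
        field_simp
        rw [mul_pow, mul_pow]
        ring_nf
        rw [show (4 : ℝ) = 2 ^ 2 by norm_num, ← pow_mul]
        ring
    _ ≤ ENNReal.ofReal A * ∫⁻ w in Metric.ball (z₀ : ℂ) (δ * z₀.im),
          ENNReal.ofReal (‖g w‖ ^ 2) := by gcongr
    _ = ∫⁻ w in Metric.ball (z₀ : ℂ) (δ * z₀.im), ENNReal.ofReal A *
          ENNReal.ofReal (‖g w‖ ^ 2) := (lintegral_const_mul' _ _ ENNReal.ofReal_ne_top).symm
    _ ≤ _ := by
        refine setLIntegral_mono' Metric.isOpen_ball.measurableSet fun w hw => ?_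
        rw [← ENNReal.ofReal_mul hA]
        refine ENNReal.ofReal_le_ofReal ?_
        have hw' : ‖w - z₀‖ ≤ δ * z₀.im := by
          simpa [dist_eq_norm] using (Metric.ball_subset_closedBall hw)
        have h := mul_normSq_sub_conj_le hR hw'
        have h2 : (1 - R ^ 2) / (4 * z₀.im) * ‖w - c‖ ^ 2 ≤ w.im := by
          rw [div_mul_eq_mul_div, div_le_iff₀ (by positivity)]
          linarith
        have h3 := pow_le_pow_left₀ (by
          have : 0 ≤ 1 - R ^ 2 := by nlinarith
          positivity) h2 (2 * m)
        calc A * ‖g w‖ ^ 2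
            = ((1 - R ^ 2) / (4 * z₀.im) * ‖w - c‖ ^ 2) ^ (2 * m) * ‖F w‖ ^ 2 := by
              simp only [g, A, norm_mul, norm_pow]
              rw [mul_pow _ (‖w - c‖ ^ 2)]
              ring
          _ ≤ _ := by gcongr

end HypSurface

namespace HypSurface

/-! ### The `L²` inner product on the space of `k`-differentials -/

section L2

variable {Γ : Subgroup PSL(2, ℝ)} {k : ℕ} {F : Set ℍ}

theorem continuous_kDifferential (ω : kDifferentials Γ k) : Continuous ω.1 := ω.2.1.continuous

theorem hypNorm_proj (ω : kDifferentials Γ k) (z : ℍ) :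
    hypNorm ω (proj Γ z) = z.im ^ k * ‖ω.1 z‖ := rfl

theorem hypNorm_smul (ω : kDifferentials Γ k) (γ : Γ) (z : ℍ) :
    (γ • z).im ^ k * ‖ω.1 (γ • z)‖ = z.im ^ k * ‖ω.1 z‖ :=
  norm_invariant ω _ _ ⟨γ, rfl⟩

theorem exists_hypNorm_le (hΓ : IsSurfaceGroup Γ) (ω : kDifferentials Γ k) :
    ∃ C : ℝ, ∀ z : ℍ, z.im ^ k * ‖ω.1 z‖ ≤ C := by
  obtain ⟨K, hK, hcov⟩ := hΓ.exists_compact_cover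
  have hω := continuous_kDifferential ω
  obtain ⟨C, hC⟩ := hK.exists_bound_of_continuousOn (f := fun z : ℍ => z.im ^ k * ‖ω.1 z‖)
    (by fun_prop)
  refine ⟨C, fun z => ?_⟩
  obtain ⟨γ, hγ⟩ := hcov z
  rw [← hypNorm_smul ω γ z]
  exact (le_abs_self _).trans (hC _ hγ)

theorem integrableOn_l2Inner (hΓ : IsSurfaceGroup Γ)
    (hF : IsFundamentalDomain Γ F (volume : Measure ℍ)) (ω η : kDifferentials Γ k) :
    IntegrableOn (fun z : ℍ => ((z.im : ℝ) : ℂ) ^ (2 * k) * ω.1 z * conj (η.1 z)) F := by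
  obtain ⟨C, hC⟩ := exists_hypNorm_le hΓ ω
  obtain ⟨C', hC'⟩ := exists_hypNorm_le hΓ η
  have hω := continuous_kDifferential ω
  have hη := continuous_kDifferential η
  refine Measure.integrableOn_of_bounded (M := C * C') (hΓ.volume_lt_top hF).ne
    (Continuous.aestronglyMeasurable ?_) (Filter.Eventually.of_forall fun z => ?_)
  · exact ((Complex.continuous_ofReal.comp UpperHalfPlane.continuous_im).pow _).mul hω |>.mul
      (Complex.continuous_conj.comp hη)
  · have hz := z.im_pos
    have h : ‖((z.im : ℝ) : ℂ) ^ (2 * k) * ω.1 z * conj (η.1 z)‖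
        = (z.im ^ k * ‖ω.1 z‖) * (z.im ^ k * ‖η.1 z‖) := by
      rw [norm_mul, norm_mul, norm_pow, Complex.norm_real, RCLike.norm_conj,
        Real.norm_of_nonneg hz.le]
      ring
    rw [h]
    exact mul_le_mul (hC z) (hC' z) (by positivity) ((by positivity : (0 : ℝ) ≤ _).trans (hC z))

theorem l2Inner_self (F : Set ℍ) (ω : kDifferentials Γ k) :
    l2Inner F ω ω = ((∫ z in F, (z.im ^ k * ‖ω.1 z‖) ^ 2 : ℝ) : ℂ) := by
  rw [l2Inner, ← integral_complex_ofReal]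
  congr 1
  funext z
  rw [mul_assoc, Complex.mul_conj, Complex.normSq_eq_norm_sq]
  push_cast
  ring

theorem integrableOn_hypNorm_sq (hΓ : IsSurfaceGroup Γ)
    (hF : IsFundamentalDomain Γ F (volume : Measure ℍ)) (ω : kDifferentials Γ k) :
    IntegrableOn (fun z : ℍ => (z.im ^ k * ‖ω.1 z‖) ^ 2) F := by
  refine (integrableOn_l2Inner hΓ hF ω ω).norm.congr (Filter.Eventually.of_forall fun z => ?_)
  have hz := z.im_pos
  simp only [norm_mul, norm_pow, Complex.norm_real, RCLike.norm_conj, Real.norm_of_nonneg hz.le]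
  ring

theorem l2Inner_conj_symm (F : Set ℍ) (ω η : kDifferentials Γ k) :
    conj (l2Inner F ω η) = l2Inner F η ω := by
  rw [l2Inner, l2Inner, ← integral_conj]
  congr 1
  funext z
  simp only [map_mul, map_pow, Complex.conj_ofReal, Complex.conj_conj]
  ring

/-- The linear form `ω ↦ ⟨ω, η⟩`. -/
noncomputable def l2InnerLeft (hΓ : IsSurfaceGroup Γ)
    (hF : IsFundamentalDomain Γ F (volume : Measure ℍ)) (η : kDifferentials Γ k) :
    kDifferentials Γ k →ₗ[ℂ] ℂ where
  toFun ω := l2Inner F ω η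
  map_add' ω ω' := by
    rw [l2Inner, l2Inner, l2Inner, ← integral_add (integrableOn_l2Inner hΓ hF ω η)
      (integrableOn_l2Inner hΓ hF ω' η)]
    congr 1
    funext z
    simp only [Submodule.coe_add, Pi.add_apply]
    ring
  map_smul' c ω := by
    rw [l2Inner, l2Inner, RingHom.id_apply, smul_eq_mul, ← integral_const_mul]
    congr 1
    funext z
    simp only [Submodule.coe_smul, Pi.smul_apply, smul_eq_mul]
    ring

/-- The bound in the sub-mean value inequality for `‖ω‖_hyp²` on a disc of Euclidean radius
`2 R / (1 + R) * Im z`, which lies in the disc of radius `R` of the Cayley coordinate at `z`. -/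
noncomputable def meanConst (R : ℝ) (k : ℕ) : ℝ :=
  1 / (Real.pi * (2 * R / (1 + R)) ^ 2 * (1 - R ^ 2) ^ (2 * k - 2))

theorem meanConst_pos {R : ℝ} (hR : 0 < R) (hR1 : R < 1) (k : ℕ) : 0 < meanConst R k := by
  have : 0 < 1 - R ^ 2 := by nlinarith
  unfold meanConst
  have := Real.pi_pos
  positivity

/-- Point evaluation is bounded on `L²`: the disc of hyperbolic radius `r_X / 2` injects
into `X`. -/
theorem hypNorm_sq_le (hΓ : IsSurfaceGroup Γ) (hF : IsFundamentalDomain Γ F (volume : Measure ℍ))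
    (hk : 1 ≤ k) {R : ℝ} (hR : 0 < R) (hRr : R ≤ Real.tanh (injRadius Γ / 4))
    (ω : kDifferentials Γ k) (z₀ : ℍ) :
    (z₀.im ^ k * ‖ω.1 z₀‖) ^ 2 ≤ meanConst R k * (l2Inner F ω ω).re := by
  have := countable_of_discrete hΓ.discrete
  have hR1 : R < 1 := hRr.trans_lt (Real.tanh_lt_one _)
  rw [l2Inner_self, Complex.ofReal_re]
  have h1 := le_setLIntegral_disc ω.2.1 hk z₀ hR hR1
  have hD : MeasurableSet {z : ℍ | ‖(z : ℂ) - z₀‖ < 2 * R / (1 + R) * z₀.im} := by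
    refine (isOpen_lt ?_ continuous_const).measurableSet
    fun_prop
  have h2 := setLIntegral_le_of_dist_lt hF
    (φ := fun z => ENNReal.ofReal ((z.im ^ k * ‖ω.1 z‖) ^ 2))
    (fun γ z => by simp only [hypNorm_smul]) hD (z₀ := z₀)
    (fun z hz => dist_lt_of_norm_sub_lt hR (hRr.trans_eq (by congr 1; ring)) hz)
  have h3 := h1.trans h2
  rw [← ofReal_integral_eq_lintegral_ofReal (integrableOn_hypNorm_sq hΓ hF ω)
    (Filter.Eventually.of_forall fun z => by positivity),
    ENNReal.ofReal_le_ofReal_iff (integral_nonneg fun z => by positivity)] at h3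
  have : 0 < 1 - R ^ 2 := by nlinarith
  have hpi := Real.pi_pos
  rw [meanConst, one_div_mul_eq_div, le_div_iff₀ (by positivity)]
  linarith

theorem eq_zero_of_l2Inner_self (hΓ : IsSurfaceGroup Γ)
    (hF : IsFundamentalDomain Γ F (volume : Measure ℍ)) (hk : 1 ≤ k) {ω : kDifferentials Γ k}
    (h : l2Inner F ω ω = 0) : ω = 0 := by
  have hr := hΓ.injRadius_pos
  have hR : 0 < Real.tanh (injRadius Γ / 4) := tanh_pos (by positivity)
  refine Subtype.ext (funext fun z => ?_)
  have hz := hypNorm_sq_le hΓ hF hk hR le_rfl ω z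
  rw [h, Complex.zero_re, mul_zero] at hz
  have h0 := pow_eq_zero_iff two_ne_zero |>.1 (le_antisymm hz (sq_nonneg _))
  have := z.im_pos
  exact norm_eq_zero.1 ((mul_eq_zero.1 h0).resolve_left (by positivity))

/-- The `L²` inner product as an inner product in Mathlib's sense, which is linear in the second
variable; hence the exchange of the arguments. -/
@[reducible]
noncomputable def l2Core (hΓ : IsSurfaceGroup Γ)
    (hF : IsFundamentalDomain Γ F (volume : Measure ℍ)) (hk : 1 ≤ k) :
    InnerProductSpace.Core ℂ (kDifferentials Γ k) where
  inner ω η := l2Inner F η ω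
  conj_inner_symm ω η := l2Inner_conj_symm F ω η
  re_inner_nonneg ω := by
    rw [l2Inner_self]
    exact integral_nonneg fun z => by positivity
  add_left ω η θ := by
    rw [← l2Inner_conj_symm, ← l2Inner_conj_symm F ω, ← l2Inner_conj_symm F η, ← map_add]
    exact congrArg conj ((l2InnerLeft hΓ hF θ).map_add ω η)
  smul_left ω η c := by
    rw [← l2Inner_conj_symm, ← l2Inner_conj_symm F ω, ← map_mul]
    exact congrArg conj ((l2InnerLeft hΓ hF η).map_smul c ω)
  definite ω h := eq_zero_of_l2Inner_self hΓ hF hk h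

theorem l2Inner_sum_smul (hΓ : IsSurfaceGroup Γ)
    (hF : IsFundamentalDomain Γ F (volume : Measure ℍ)) {n : ℕ} {ω : Fin n → kDifferentials Γ k}
    (hω : IsL2Orthonormal F ω) (a : Fin n → ℂ) :
    l2Inner F (∑ i, a i • ω i) (∑ i, a i • ω i) = ((∑ i, ‖a i‖ ^ 2 : ℝ) : ℂ) := by
  have h1 : ∀ η, l2Inner F (∑ i, a i • ω i) η = ∑ i, a i * l2Inner F (ω i) η := fun η => by
    refine (map_sum (l2InnerLeft hΓ hF η) _ _).trans (Finset.sum_congr rfl fun i _ => ?_)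
    exact (l2InnerLeft hΓ hF η).map_smul (a i) (ω i)
  have h2 : ∀ j, l2Inner F (ω j) (∑ i, a i • ω i) = conj (a j) := fun j => by
    rw [← l2Inner_conj_symm, h1]
    simp [hω _ j]
  rw [h1]
  simp_rw [h2, Complex.mul_conj, Complex.normSq_eq_norm_sq]
  push_cast
  rfl

/-- The Bergman kernel is bounded by the constant of the sub-mean value inequality: apply it to the
extremal differential `∑ i, conj (ω_i(z)) ω_i`. -/
theorem bergmanKernel_le (hΓ : IsSurfaceGroup Γ)
    (hF : IsFundamentalDomain Γ F (volume : Measure ℍ)) (hk : 1 ≤ k) {R : ℝ} (hR : 0 < R)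
    (hRr : R ≤ Real.tanh (injRadius Γ / 4)) {n : ℕ} {ω : Fin n → kDifferentials Γ k}
    (hω : IsL2Orthonormal F ω) (z : ℍ) :
    bergmanKernel ω (proj Γ z) ≤ meanConst R k := by
  set S : ℝ := ∑ i, ‖(ω i).1 z‖ ^ 2 with hS
  have hB : bergmanKernel ω (proj Γ z) = (z.im ^ k) ^ 2 * S := by
    simp_rw [bergmanKernel, hypNorm_proj, mul_pow, hS, Finset.mul_sum]
  have hR1 : R < 1 := hRr.trans_lt (Real.tanh_lt_one _)
  have hS0 : 0 ≤ S := Finset.sum_nonneg fun i _ => by positivity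
  have h := hypNorm_sq_le hΓ hF hk hR hRr (∑ i, conj ((ω i).1 z) • ω i) z
  rw [l2Inner_sum_smul hΓ hF hω] at h
  have hval : (∑ i, conj ((ω i).1 z) • ω i : kDifferentials Γ k).1 z = (S : ℂ) := by
    simp only [AddSubmonoidClass.coe_finsetSum, Finset.sum_apply, Submodule.coe_smul,
      Pi.smul_apply, smul_eq_mul, hS]
    push_cast
    refine Finset.sum_congr rfl fun i _ => ?_
    rw [mul_comm, Complex.mul_conj, Complex.normSq_eq_norm_sq]
    push_cast
    rfl
  rw [hval, Complex.norm_real, Real.norm_of_nonneg hS0] at h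
  simp only [RCLike.norm_conj, Complex.ofReal_re, ← hS] at h
  rw [hB]
  rcases hS0.eq_or_lt with h0 | hpos
  · rw [← h0, mul_zero]
    exact (meanConst_pos hR hR1 k).le
  · refine le_of_mul_le_mul_right ?_ hpos
    linarith

end L2

/-- If the length of orthonormal families is bounded, the space is finite-dimensional (by
Gram-Schmidt) and has an orthonormal basis. -/
theorem exists_orthonormalBasis_of_core {V : Type*} [AddCommGroup V] [Module ℂ V]
    (c : InnerProductSpace.Core ℂ V) (N : ℕ)
    (hN : ∀ (n : ℕ) (e : Fin n → V), (∀ i j, c.inner (e i) (e j) = if i = j then 1 else 0) →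
      n ≤ N) :
    ∃ (n : ℕ) (b : Module.Basis (Fin n) ℂ V),
      ∀ i j, c.inner (b i) (b j) = if i = j then 1 else 0 := by
  let : NormedAddCommGroup V := c.toNormedAddCommGroup
  let : InnerProductSpace ℂ V := InnerProductSpace.ofCore c.toCore
  have hrank : Module.rank ℂ V ≤ N := by
    refine rank_le fun s hs => ?_
    have hli := hs.comp s.equivFin.symm s.equivFin.symm.injective
    exact hN _ _ (orthonormal_iff_ite.1 (InnerProductSpace.gramSchmidtNormed_orthonormal hli))
  have : FiniteDimensional ℂ V :=
    Module.rank_lt_aleph0_iff.1 (hrank.trans_lt Cardinal.natCast_lt_aleph0)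
  exact ⟨_, (stdOrthonormalBasis ℂ V).toBasis, fun i j => by
    have := orthonormal_iff_ite.1 (stdOrthonormalBasis ℂ V).orthonormal i j
    simpa using this⟩

/-- Integrating the pointwise bound of the Bergman kernel over `F` bounds the number of elements
of an orthonormal family. -/
theorem exists_l2Orthonormal_basis {Γ : Subgroup PSL(2, ℝ)} (hΓ : IsSurfaceGroup Γ) {F : Set ℍ}
    (hF : IsFundamentalDomain Γ F (volume : Measure ℍ)) {k : ℕ} (hk : 1 ≤ k) :
    ∃ (n : ℕ) (ω : Module.Basis (Fin n) ℂ (kDifferentials Γ k)), IsL2Orthonormal F ω := by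
  have hr := hΓ.injRadius_pos
  have hR : 0 < Real.tanh (injRadius Γ / 4) := tanh_pos (by positivity)
  set M := meanConst (Real.tanh (injRadius Γ / 4)) k
  have hbound : ∀ (n : ℕ) (e : Fin n → kDifferentials Γ k), IsL2Orthonormal F e →
      (n : ℝ) ≤ M * volume.real F := by
    intro n e he
    have hint : ∀ i, ∫ z in F, (z.im ^ k * ‖(e i).1 z‖) ^ 2 = 1 := fun i => by
      have := he i i
      rw [l2Inner_self, if_pos rfl] at this
      exact_mod_cast this
    calc (n : ℝ) = ∑ i, ∫ z in F, (z.im ^ k * ‖(e i).1 z‖) ^ 2 := by simp [hint]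
      _ = ∫ z in F, ∑ i, (z.im ^ k * ‖(e i).1 z‖) ^ 2 :=
          (integral_finsetSum _ fun i _ => integrableOn_hypNorm_sq hΓ hF (e i)).symm
      _ ≤ ∫ z in F, M := by
          refine integral_mono (integrable_finsetSum _ fun i _ =>
            integrableOn_hypNorm_sq hΓ hF (e i)) ?_ fun z =>
              bergmanKernel_le hΓ hF hk hR le_rfl he z
          exact integrableOn_const (hΓ.volume_lt_top hF).ne
      _ = M * volume.real F := by
          rw [setIntegral_const, smul_eq_mul, mul_comm]
  obtain ⟨N, hN⟩ := exists_nat_ge (M * volume.real F)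
  obtain ⟨n, b, hb⟩ := exists_orthonormalBasis_of_core (l2Core hΓ hF hk) N fun n e he => by
    have : IsL2Orthonormal F e := fun i j => by
      have := he j i
      simp only [eq_comm (a := j)] at this
      exact this
    exact_mod_cast (hbound n e this).trans hN
  refine ⟨n, b, fun i j => ?_⟩
  have := hb j i
  simp only [eq_comm (a := j)] at this
  exact this

end HypSurface

namespace HypSurface

/-! ### The Levi form of the logarithm of the Bergman kernel -/

section Wirtinger

open scoped InnerProductSpace Topology

theorem fderiv_eq_of_hasLineDerivAt {u : ℂ → ℂ} {z h a : ℂ} (hu : DifferentiableAt ℝ u z)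
    (ha : HasLineDerivAt ℝ u a z h) : fderiv ℝ u z h = a := by
  rw [← hu.lineDeriv_eq_fderiv, ha.lineDeriv]

theorem wirtingerZ_congr {u v : ℂ → ℂ} {z : ℂ} (h : u =ᶠ[𝓝 z] v) :
    wirtingerZ u z = wirtingerZ v z := by
  rw [wirtingerZ, wirtingerZ, h.fderiv_eq]

theorem wirtingerZbar_congr {u v : ℂ → ℂ} {z : ℂ} (h : u =ᶠ[𝓝 z] v) :
    wirtingerZbar u z = wirtingerZbar v z := by
  rw [wirtingerZbar, wirtingerZbar, h.fderiv_eq]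

/-- A consequence of the default value of `fderiv`. -/
theorem wirtingerZ_eq_zero_of_not_differentiableAt {u : ℂ → ℂ} {z : ℂ}
    (h : ¬ DifferentiableAt ℝ u z) : wirtingerZ u z = 0 := by
  simp [wirtingerZ, fderiv_zero_of_not_differentiableAt h]

variable {E : Type*} [NormedAddCommGroup E] [InnerProductSpace ℂ E]

/-- The function `log (y^(2k) ‖V‖²)` for a vector-valued function `V`, with values in `ℂ`
as the Wirtinger derivatives require. -/
noncomputable def logWeighted (k : ℕ) (V : ℂ → E) (w : ℂ) : ℂ :=
  ((Real.log (w.im ^ (2 * k) * ‖V w‖ ^ 2) : ℝ) : ℂ)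

theorem hasDerivAt_line {V : ℂ → E} {V' : E} {w : ℂ} (hV : HasDerivAt V V' w) (h : ℂ) :
    HasDerivAt (fun t : ℝ => V (w + t • h)) (h • V') 0 := by
  have h1 : HasDerivAt (fun t : ℝ => w + t • h) h 0 := by
    simpa using ((hasDerivAt_id (0 : ℝ)).smul_const h).const_add w
  have h2 : HasDerivAt V V' (w + (0 : ℝ) • h) := by simpa using hV
  exact h2.scomp (0 : ℝ) h1

theorem hasDerivAt_im_line (w h : ℂ) : HasDerivAt (fun t : ℝ => (w + t • h).im) h.im 0 := by
  simpa using ((hasDerivAt_id (0 : ℝ)).mul_const h.im).const_add w.im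

theorem wirtingerZbar_logWeighted {k : ℕ} {V : ℂ → E} {V' : E} {w : ℂ} (hV : HasDerivAt V V' w)
    (hw : 0 < w.im) (hne : V w ≠ 0) :
    wirtingerZbar (logWeighted k V) w =
      Complex.I * k / (w.im : ℂ) + ⟪V', V w⟫_ℂ / ⟪V w, V w⟫_ℂ := by
  have hpos : 0 < ‖V w‖ := norm_pos_iff.2 hne
  have hline : ∀ h : ℂ, HasLineDerivAt ℝ (logWeighted k V)
      ((2 * k * h.im / w.im + 2 * (⟪V w, h • V'⟫_ℂ).re / ‖V w‖ ^ 2 : ℝ) : ℂ) w h := by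
    intro h
    have h1 := hasDerivAt_line hV h
    have h2 : HasDerivAt (fun t : ℝ => ‖V (w + t • h)‖ ^ 2) (2 * (⟪V w, h • V'⟫_ℂ).re) 0 := by
      have := (h1.inner ℂ h1)
      have := (Complex.reCLM.hasFDerivAt (x := ⟪V (w + (0 : ℝ) • h), V (w + (0 : ℝ) • h)⟫_ℂ)
        ).comp_hasDerivAt (0 : ℝ) this
      refine (this.congr_deriv ?_).congr_of_eventuallyEq (Filter.Eventually.of_forall fun t =>
        (inner_self_eq_norm_sq (𝕜 := ℂ) (V (w + t • h))).symm)
      simp only [zero_smul, add_zero, Complex.reCLM_apply, Complex.add_re]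
      rw [← inner_conj_symm (h • V') (V w), Complex.conj_re]
      ring
    have h3 := ((hasDerivAt_im_line w h).pow (2 * k)).mul h2
    have h4 := (h3.log (by
      simp only [Pi.mul_apply, Pi.pow_apply, zero_smul, add_zero]
      positivity)).ofReal_comp
    refine h4.congr_deriv ?_
    congr 1
    simp only [Pi.mul_apply, Pi.pow_apply, zero_smul, add_zero]
    rcases k.eq_zero_or_pos with rfl | hk
    · simp
    · obtain ⟨m, hm⟩ : ∃ m, 2 * k = m + 1 := ⟨2 * k - 1, by omega⟩
      have hm' : (2 * (k : ℝ)) = m + 1 := by exact_mod_cast hm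
      rw [hm, hm']
      simp only [Nat.add_sub_cancel]
      push_cast
      field_simp
      ring
  have hdiff : DifferentiableAt ℝ (logWeighted k V) w := by
    have hV' := hV.differentiableAt.restrictScalars ℝ
    have h2 : DifferentiableAt ℝ (fun w => ‖V w‖ ^ 2) w := by
      have := (Complex.reCLM.differentiableAt).comp w (hV'.inner ℂ hV')
      exact this.congr_of_eventuallyEq (Filter.Eventually.of_forall fun x =>
        (inner_self_eq_norm_sq (𝕜 := ℂ) (V x)).symm)
    have h3 : DifferentiableAt ℝ (fun w : ℂ => w.im ^ (2 * k)) w :=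
      (Complex.imCLM.differentiableAt).pow _
    exact (Complex.ofRealCLM.differentiableAt).comp w
      ((h3.mul h2).log (by simp only [Pi.mul_apply]; positivity))
  rw [wirtingerZbar, fderiv_eq_of_hasLineDerivAt hdiff (hline 1),
    fderiv_eq_of_hasLineDerivAt hdiff (hline Complex.I)]
  rw [← inner_conj_symm V' (V w), inner_self_eq_norm_sq_to_K]
  have hpos' : ((‖V w‖ : ℝ) : ℂ) ≠ 0 := by exact_mod_cast hpos.ne'
  have hw' : ((w.im : ℝ) : ℂ) ≠ 0 := by exact_mod_cast hw.ne'
  have hconj : ∀ p : ℂ, conj p = p.re - p.im * Complex.I := fun p => by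
    apply Complex.ext <;> simp
  rw [hconj]
  simp only [inner_smul_right, one_mul, Complex.one_im, Complex.I_im, Complex.I_mul_re,
    Complex.coe_algebraMap]
  push_cast
  field_simp
  ring

theorem ddbarCoeff_logWeighted [CompleteSpace E] {k : ℕ} {V : ℂ → E} {w : ℂ}
    (hV : AnalyticAt ℂ V w) (hw : 0 < w.im) (hne : V w ≠ 0) :
    ddbarCoeff (logWeighted k V) w = -(k / (2 * (w.im : ℂ) ^ 2)) +
      (⟪deriv V w, deriv V w⟫_ℂ / ⟪V w, V w⟫_ℂ
        - ⟪deriv V w, V w⟫_ℂ * ⟪V w, deriv V w⟫_ℂ / ⟪V w, V w⟫_ℂ ^ 2) := by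
  have hev : wirtingerZbar (logWeighted k V) =ᶠ[𝓝 w] fun w =>
      Complex.I * k / (w.im : ℂ) + ⟪deriv V w, V w⟫_ℂ / ⟪V w, V w⟫_ℂ := by
    filter_upwards [hV.eventually_analyticAt, hV.continuousAt.eventually_ne hne,
      (isOpen_lt continuous_const Complex.continuous_im).mem_nhds hw] with x hx hx' hx''
    exact wirtingerZbar_logWeighted hx.differentiableAt.hasDerivAt hx'' hx'
  rw [ddbarCoeff, wirtingerZ_congr hev]
  set G : ℂ → ℂ := fun w => Complex.I * k / (w.im : ℂ) + ⟪deriv V w, V w⟫_ℂ / ⟪V w, V w⟫_ℂ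
  have hS : ⟪V w, V w⟫_ℂ ≠ 0 := inner_self_ne_zero.2 hne
  have hy : (w.im : ℂ) ≠ 0 := by exact_mod_cast hw.ne'
  have hline : ∀ h : ℂ, HasLineDerivAt ℝ G
      (-(Complex.I * k * h.im / (w.im : ℂ) ^ 2) +
        ((h * ⟪deriv V w, deriv V w⟫_ℂ + conj h * ⟪deriv (deriv V) w, V w⟫_ℂ) / ⟪V w, V w⟫_ℂ -
        ⟪deriv V w, V w⟫_ℂ * (h * ⟪V w, deriv V w⟫_ℂ + conj h * ⟪deriv V w, V w⟫_ℂ)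
          / ⟪V w, V w⟫_ℂ ^ 2)) w h := by
    intro h
    have h0 := hasDerivAt_line hV.differentiableAt.hasDerivAt h
    have h1 := hasDerivAt_line hV.deriv.differentiableAt.hasDerivAt h
    have him := (hasDerivAt_im_line w h).ofReal_comp
    have hA := (hasDerivAt_const (0 : ℝ) (Complex.I * k)).div him (by simpa using hw.ne')
    have hB := (h1.inner ℂ h0).div (h0.inner ℂ h0) (by simpa using hne)
    refine (hA.add hB).congr_deriv ?_
    simp only [zero_smul, add_zero, inner_smul_left, inner_smul_right]
    field_simp
    ring
  have hdiff : DifferentiableAt ℝ G w := by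
    have h0 := hV.differentiableAt.restrictScalars ℝ
    have h1 := hV.deriv.differentiableAt.restrictScalars ℝ
    have him : DifferentiableAt ℝ (fun w : ℂ => (w.im : ℂ)) w :=
      (Complex.ofRealCLM.comp Complex.imCLM).differentiableAt
    have hA := (him.inv hy).const_mul (Complex.I * k)
    have hB := (h1.inner ℂ h0).mul ((h0.inner ℂ h0).inv hS)
    have hG : G = (fun w : ℂ => Complex.I * k * (w.im : ℂ)⁻¹)
        + (fun w => ⟪deriv V w, V w⟫_ℂ) * fun w => (⟪V w, V w⟫_ℂ)⁻¹ := by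
      funext w
      simp only [G, Pi.add_apply, Pi.mul_apply, div_eq_mul_inv]
    rw [hG]
    exact hA.add hB
  rw [wirtingerZ, fderiv_eq_of_hasLineDerivAt hdiff (hline 1),
    fderiv_eq_of_hasLineDerivAt hdiff (hline Complex.I)]
  simp only [Complex.one_im, Complex.I_im, map_one, Complex.conj_I, Complex.ofReal_one,
    Complex.ofReal_zero]
  field_simp
  ring_nf
  simp only [Complex.I_sq]
  ring

/-- At a zero of `V` the function `wirtingerZbar (logWeighted k V)` is not differentiable, unless
`V` vanishes identically nearby: for `V = (z - w)^m h` with `h(w) ≠ 0` it has the singular part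
`m / conj (z - w)`. Hence its derivatives take the default value `0` of `fderiv`. -/
theorem ddbarCoeff_logWeighted_of_eq_zero [CompleteSpace E] {k : ℕ} {V : ℂ → E} {w : ℂ}
    (hV : AnalyticAt ℂ V w) (hw : 0 < w.im) (h0 : V w = 0) :
    ddbarCoeff (logWeighted k V) w = 0 := by
  by_cases hz : ∀ᶠ z in 𝓝 w, V z = 0
  · have h1 : wirtingerZbar (logWeighted k V) =ᶠ[𝓝 w] fun _ => 0 := by
      filter_upwards [hz.eventually_nhds] with z hz'
      have h2 : logWeighted k V =ᶠ[𝓝 z] fun _ => 0 := by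
        filter_upwards [hz'] with x hx
        simp [logWeighted, hx]
      rw [wirtingerZbar_congr h2]
      simp [wirtingerZbar]
    rw [ddbarCoeff, wirtingerZ_congr h1]
    simp [wirtingerZ]
  · obtain ⟨m, g, hg, hgw, hVg⟩ := hV.exists_eventuallyEq_pow_smul_nonzero_iff.2 hz
    have hm : m ≠ 0 := by
      rintro rfl
      have := hVg.self_of_nhds
      rw [h0, pow_zero, one_smul] at this
      exact hgw this.symm
    refine wirtingerZ_eq_zero_of_not_differentiableAt fun hdiff => ?_
    set P : ℂ → ℂ := fun z => wirtingerZbar (logWeighted k V) z - Complex.I * k / (z.im : ℂ)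
      - ⟪deriv g z, g z⟫_ℂ / ⟪g z, g z⟫_ℂ
    have hP : ContinuousAt P w := by
      have him : ContinuousAt (fun z : ℂ => (z.im : ℂ)) w := by fun_prop
      refine (hdiff.continuousAt.sub (continuousAt_const.div him ?_)).sub
        ((hg.deriv.continuousAt.inner hg.continuousAt).div
          (hg.continuousAt.inner hg.continuousAt) (inner_self_ne_zero.2 hgw))
      exact_mod_cast hw.ne'
    have hPev : ∀ᶠ z in 𝓝[≠] w, P z * conj (z - w) = m := by
      filter_upwards [eventually_nhdsWithin_of_eventually_nhds hVg.eventually_nhds,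
        eventually_nhdsWithin_of_eventually_nhds hg.eventually_analyticAt,
        eventually_nhdsWithin_of_eventually_nhds (hg.continuousAt.eventually_ne hgw),
        eventually_nhdsWithin_of_eventually_nhds
          ((isOpen_lt continuous_const Complex.continuous_im).mem_nhds hw),
        self_mem_nhdsWithin] with z hVz hgz hgz' hzim hzw
      have hzw' : z - w ≠ 0 := sub_ne_zero.2 hzw
      have hVz0 : V z = (z - w) ^ m • g z := hVz.self_of_nhds
      have hder : HasDerivAt V ((z - w) ^ m • deriv g z + (m * (z - w) ^ (m - 1)) • g z) z := by
        have h1 : HasDerivAt (fun z => (z - w) ^ m) (m * (z - w) ^ (m - 1)) z := by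
          simpa using ((hasDerivAt_id z).sub_const w).fun_pow m
        exact (h1.smul hgz.differentiableAt.hasDerivAt).congr_of_eventuallyEq hVz
      have hne : V z ≠ 0 := by
        rw [hVz0]
        exact smul_ne_zero (pow_ne_zero _ hzw') hgz'
      have hgg : ⟪g z, g z⟫_ℂ ≠ 0 := inner_self_ne_zero.2 hgz'
      have hc : conj (z - w) ≠ 0 := (map_ne_zero _).2 hzw'
      obtain ⟨l, rfl⟩ := Nat.exists_eq_succ_of_ne_zero hm
      simp only [P]
      rw [wirtingerZbar_logWeighted hder hzim hne, hVz0]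
      simp only [inner_add_left, inner_smul_left, inner_smul_right, map_mul, map_pow,
        map_natCast, Nat.succ_eq_add_one, Nat.add_sub_cancel]
      field_simp
      ring
    have hlim : Filter.Tendsto (fun z => P z * conj (z - w)) (𝓝[≠] w)
        (𝓝 (P w * conj (w - w))) := by
      refine Filter.Tendsto.mono_left (ContinuousAt.tendsto ?_) nhdsWithin_le_nhds
      exact hP.mul (Complex.continuous_conj.continuousAt.comp (by fun_prop))
    have hlim' := (Filter.Tendsto.congr' hPev hlim)
    rw [sub_self, map_zero, mul_zero] at hlim'
    have := tendsto_nhds_unique hlim' tendsto_const_nhds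
    exact hm (by exact_mod_cast this.symm)

end Wirtinger

end HypSurface

namespace HypSurface

section LeviForm

open scoped InnerProductSpace Topology

variable {E : Type*} [NormedAddCommGroup E] [InnerProductSpace ℂ E]

/-- `∂²/∂z∂z̄ log ‖V‖²` at a point where `V` has the value `v` and the derivative `v'`. -/
noncomputable def leviForm (v v' : E) : ℝ :=
  ‖v'‖ ^ 2 / ‖v‖ ^ 2 - ‖⟪v', v⟫_ℂ‖ ^ 2 / ‖v‖ ^ 4

theorem leviForm_nonneg (v v' : E) : 0 ≤ leviForm v v' := by
  rcases eq_or_ne v 0 with rfl | hv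
  · simp [leviForm]
  have hpos : 0 < ‖v‖ := norm_pos_iff.2 hv
  have h := norm_inner_le_norm (𝕜 := ℂ) v' v
  have h2 := pow_le_pow_left₀ (norm_nonneg _) h 2
  rw [leviForm, sub_nonneg, div_le_div_iff₀ (by positivity) (by positivity)]
  calc ‖⟪v', v⟫_ℂ‖ ^ 2 * ‖v‖ ^ 2 ≤ (‖v'‖ * ‖v‖) ^ 2 * ‖v‖ ^ 2 := by gcongr
    _ = ‖v'‖ ^ 2 * ‖v‖ ^ 4 := by ring

/-- The Levi form of `log ‖V‖²` does not change when `V` is multiplied by a nonvanishing scalar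
function, which changes `v' / v` by a constant `c`. -/
theorem leviForm_le (v v' : E) (c : ℂ) : leviForm v v' ≤ ‖v' + c • v‖ ^ 2 / ‖v‖ ^ 2 := by
  rcases eq_or_ne v 0 with rfl | hv
  · simp [leviForm]
  have hpos : 0 < ‖v‖ := norm_pos_iff.2 hv
  have h1 : ‖v' + c • v‖ ^ 2 = ‖v'‖ ^ 2 + 2 * (c * ⟪v', v⟫_ℂ).re + ‖c‖ ^ 2 * ‖v‖ ^ 2 := by
    rw [norm_add_sq (𝕜 := ℂ), inner_smul_right, norm_smul, mul_pow]
    rfl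
  have h2 : ‖⟪v', v⟫_ℂ + conj c * (‖v‖ ^ 2 : ℝ)‖ ^ 2
      = ‖⟪v', v⟫_ℂ‖ ^ 2 + 2 * (c * ⟪v', v⟫_ℂ).re * ‖v‖ ^ 2 + ‖c‖ ^ 2 * ‖v‖ ^ 4 := by
    simp only [← Complex.normSq_eq_norm_sq, Complex.normSq_apply, Complex.add_re, Complex.add_im,
      Complex.mul_re, Complex.mul_im, Complex.conj_re, Complex.conj_im, Complex.ofReal_re,
      Complex.ofReal_im]
    ring
  have h3 := sq_nonneg ‖⟪v', v⟫_ℂ + conj c * (‖v‖ ^ 2 : ℝ)‖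
  rw [h2] at h3
  have h4 : leviForm v v' = (‖v'‖ ^ 2 * ‖v‖ ^ 2 - ‖⟪v', v⟫_ℂ‖ ^ 2) / ‖v‖ ^ 4 := by
    rw [leviForm]
    field_simp
  have h5 : ‖v' + c • v‖ ^ 2 / ‖v‖ ^ 2 = ‖v' + c • v‖ ^ 2 * ‖v‖ ^ 2 / ‖v‖ ^ 4 := by
    field_simp
  rw [h4, h5, h1]
  gcongr
  linarith

theorem ddbarCoeff_logWeighted_eq_ofReal [CompleteSpace E] {k : ℕ} {V : ℂ → E} {w : ℂ}
    (hV : AnalyticAt ℂ V w) (hw : 0 < w.im) (hne : V w ≠ 0) :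
    ddbarCoeff (logWeighted k V) w
      = ((-(k / (2 * w.im ^ 2)) + leviForm (V w) (deriv V w) : ℝ) : ℂ) := by
  rw [ddbarCoeff_logWeighted hV hw hne, leviForm, ← inner_conj_symm (V w) (deriv V w),
    Complex.mul_conj, Complex.normSq_eq_norm_sq, inner_self_eq_norm_sq_to_K,
    inner_self_eq_norm_sq_to_K]
  push_cast
  rw [← pow_mul]
  rfl

/-- Cauchy's estimate for `(w - conj z₀)^(2k) V(w)`, whose norm squared is
`(4 y₀ / (1 - |u|²))^(2k)` times `y^(2k) ‖V‖²` in terms of the Cayley coordinate `u` of `w`. -/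
theorem leviForm_le_of_weighted_norm_le [CompleteSpace E] {k : ℕ} {V : ℂ → E} {M : ℝ} (z₀ : ℍ)
    (hV : DifferentiableOn ℂ V {w : ℂ | 0 < w.im})
    (hM : ∀ w : ℂ, 0 < w.im → w.im ^ (2 * k) * ‖V w‖ ^ 2 ≤ M) {R : ℝ} (hR : 0 < R) (hR1 : R < 1) :
    z₀.im ^ 2 * (z₀.im ^ (2 * k) * ‖V z₀‖ ^ 2) * leviForm (V z₀) (deriv V z₀) ≤
      M / ((2 * R / (1 + R)) ^ 2 * (1 - R ^ 2) ^ (2 * k)) := by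
  set δ := 2 * R / (1 + R) with hδ
  have hδ0 : 0 < δ := by positivity
  have hy := z₀.im_pos
  have hR2 : 0 < 1 - R ^ 2 := by nlinarith
  set c : ℂ := conj (z₀ : ℂ)
  set G : ℂ → E := fun w => (w - c) ^ (2 * k) • V w
  have hsub : Metric.closedBall (z₀ : ℂ) (δ * z₀.im) ⊆ {z : ℂ | 0 < z.im} := fun w hw =>
    im_pos_of_norm_sub_le hR hR1 (by simpa [dist_eq_norm] using hw)
  have hG : DifferentiableOn ℂ G {z : ℂ | 0 < z.im} :=
    DifferentiableOn.smul (by fun_prop) hV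
  have hM0 : 0 ≤ M := (hM z₀ hy).trans' (by have := hy; rw [← coe_im] at this; positivity)
  set A : ℝ := (4 * z₀.im / (1 - R ^ 2)) ^ (2 * k)
  have hA : 0 ≤ A := by positivity
  have hbound : ∀ w ∈ Metric.sphere (z₀ : ℂ) (δ * z₀.im), ‖G w‖ ≤ √(A * M) := by
    intro w hw
    have hw' : ‖w - z₀‖ ≤ δ * z₀.im := by
      simpa [dist_eq_norm] using (Metric.sphere_subset_closedBall hw)
    have hwim := hsub (Metric.sphere_subset_closedBall hw)
    have hwim' : 0 < w.im := hwim
    have h := mul_normSq_sub_conj_le hR hw'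
    refine Real.le_sqrt_of_sq_le ?_
    have h2 : ‖w - c‖ ^ 2 ≤ 4 * z₀.im / (1 - R ^ 2) * w.im := by
      rw [div_mul_eq_mul_div, le_div_iff₀ hR2]
      linarith
    calc ‖G w‖ ^ 2 = (‖w - c‖ ^ 2) ^ (2 * k) * ‖V w‖ ^ 2 := by
          simp only [G, norm_smul, norm_pow]
          ring
      _ ≤ (4 * z₀.im / (1 - R ^ 2) * w.im) ^ (2 * k) * ‖V w‖ ^ 2 := by gcongr
      _ = A * (w.im ^ (2 * k) * ‖V w‖ ^ 2) := by
          simp only [A]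
          rw [mul_pow, mul_assoc]
      _ ≤ A * M := by
          gcongr
          exact hM w hwim
  have hcauchy := Complex.norm_deriv_le_of_forall_mem_sphere_norm_le (mul_pos hδ0 hy)
    ((hG.mono hsub).diffContOnCl_ball subset_rfl) hbound
  have hsubc : (z₀ : ℂ) - c = 2 * z₀.im * Complex.I := by
    simp [c, Complex.sub_conj]
  have hne : (z₀ : ℂ) - c ≠ 0 := by
    rw [hsubc]
    simp [hy.ne']
  have hnorm : ‖(z₀ : ℂ) - c‖ = 2 * z₀.im := by
    rw [hsubc]
    simp [abs_of_pos hy]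
  set b : ℂ := 2 * k / ((z₀ : ℂ) - c)
  set W : E := deriv V z₀ + b • V z₀
  have hderiv : deriv G z₀ = ((z₀ : ℂ) - c) ^ (2 * k) • W := by
    have hVd := (hV.differentiableAt (isOpen_upperHalfPlaneSet.mem_nhds hy)).hasDerivAt
    have h1 : HasDerivAt (fun w : ℂ => (w - c) ^ (2 * k))
        ((2 * k : ℕ) * ((z₀ : ℂ) - c) ^ (2 * k - 1)) z₀ := by
      simpa using ((hasDerivAt_id (z₀ : ℂ)).sub_const c).fun_pow (2 * k)
    rw [show deriv G z₀ = _ from (h1.smul hVd).deriv, smul_add, smul_smul]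
    congr 2
    rcases k.eq_zero_or_pos with hk | hk
    · subst hk
      simp [b]
    · obtain ⟨m, hm⟩ : ∃ m, 2 * k = m + 1 := ⟨2 * k - 1, by omega⟩
      have hm' : (2 * (k : ℂ)) = m + 1 := by exact_mod_cast hm
      simp only [b]
      rw [hm, hm', Nat.add_sub_cancel]
      push_cast
      field_simp
      exact (pow_succ' _ _).symm
  rw [hderiv, norm_smul, norm_pow, hnorm] at hcauchy
  clear_value δ
  have hsq := pow_le_pow_left₀ (by positivity) hcauchy 2
  rw [div_pow, Real.sq_sqrt (by positivity), le_div_iff₀ (by positivity)] at hsq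
  have hW : z₀.im ^ 2 * z₀.im ^ (2 * k) * ‖W‖ ^ 2 ≤ M / (δ ^ 2 * (1 - R ^ 2) ^ (2 * k)) := by
    rw [le_div_iff₀ (by positivity)]
    have hAeq : A = (4 * z₀.im) ^ (2 * k) / (1 - R ^ 2) ^ (2 * k) := div_pow _ _ _
    rw [hAeq, div_mul_eq_mul_div, le_div_iff₀ (by positivity)] at hsq
    refine le_of_mul_le_mul_left ?_ (show 0 < (4 * z₀.im) ^ (2 * k) by positivity)
    refine le_trans (le_of_eq ?_) hsq
    have : ((2 * z₀.im) ^ (2 * k)) ^ 2 = (4 * z₀.im) ^ (2 * k) * z₀.im ^ (2 * k) := by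
      rw [← mul_pow, ← pow_mul, mul_comm (2 * k) 2, pow_mul]
      congr 1
      ring
    rw [mul_pow _ ‖W‖, this]
    ring
  refine le_trans ?_ hW
  calc z₀.im ^ 2 * (z₀.im ^ (2 * k) * ‖V z₀‖ ^ 2) * leviForm (V z₀) (deriv V z₀)
      ≤ z₀.im ^ 2 * (z₀.im ^ (2 * k) * ‖V z₀‖ ^ 2) * (‖W‖ ^ 2 / ‖V z₀‖ ^ 2) := by
        gcongr
        exact leviForm_le _ _ _
    _ = z₀.im ^ 2 * z₀.im ^ (2 * k) * (‖W‖ ^ 2 / ‖V z₀‖ ^ 2 * ‖V z₀‖ ^ 2) := by ring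
    _ ≤ z₀.im ^ 2 * z₀.im ^ (2 * k) * ‖W‖ ^ 2 := by
        gcongr
        rcases eq_or_ne (V z₀) 0 with h | h
        · simp [h]
        · rw [div_mul_cancel₀ _ (by simpa using h)]

end LeviForm

end HypSurface

namespace HypSurface

/-! ### Comparison with the constant `C_{X,k}` -/

/-- Bernoulli's inequality bounds the powers of `1 - R²` for `R² ≤ 1 / (4 k)`. -/
theorem half_le_pow {k : ℕ} {x : ℝ} (hk : 1 ≤ k) (hx : 1 - 1 / (4 * k) ≤ x) (hx1 : x ≤ 1) :
    ∀ m ≤ 2 * k, 1 / 2 ≤ x ^ m := by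
  intro m hm
  have hk' : (1 : ℝ) ≤ k := by exact_mod_cast hk
  have hk0 : 1 / (4 * (k : ℝ)) ≤ 1 := by
    rw [div_le_one (by positivity)]
    linarith
  have hx0 : 0 ≤ x := by linarith
  have hb := one_add_mul_le_pow (a := -(1 / (4 * (k : ℝ)))) (by linarith) (2 * k)
  calc (1 : ℝ) / 2 = 1 + ((2 * k : ℕ) : ℝ) * -(1 / (4 * (k : ℝ))) := by
        push_cast
        field_simp
        norm_num
    _ ≤ (1 + -(1 / (4 * (k : ℝ)))) ^ (2 * k) := hb
    _ ≤ x ^ (2 * k) := by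
        refine pow_le_pow_left₀ (by linarith) (by linarith) _
    _ ≤ x ^ m := pow_le_pow_of_le_one hx0 hx1 hm

/-- Two of the summands of `C_{X,k}`, all of which are nonnegative. -/
theorem le_constC {r : ℝ} (hr : 0 < r) {k : ℕ} (hk : 3 ≤ k) :
    (2 * k - 1) / (2 * Real.pi) ≤ constC r k ∧
      (2 * k - 1) / (2 * Real.pi * Real.sinh (r / 4) ^ 2) *
        (1 / ((k - 2) * Real.cosh (r / 2) ^ (2 * k - 4))) ≤ constC r k := by
  have hk' : (3 : ℝ) ≤ k := by exact_mod_cast hk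
  have hpi := Real.pi_pos
  have h1 : (0 : ℝ) < 2 * k - 1 := by linarith
  have h2 : (0 : ℝ) < 2 * k - 2 := by linarith
  have h3 : (0 : ℝ) < k - 2 := by linarith
  have hs : 0 < Real.sinh (r / 4) := Real.sinh_pos_iff.2 (by positivity)
  have hc := Real.cosh_pos (r / 4)
  have hc' := Real.cosh_pos (r / 2)
  unfold constC
  constructor
  · have e1 : (2 * k - 1) / (2 * Real.pi) = (2 * k - 1) / (4 * Real.pi) * 2 := by
      field_simp; norm_num
    have e2 : 0 ≤ (2 * k - 1) / (4 * Real.pi) *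
      (16 / Real.cosh (r / 4) ^ (2 * k - 4) + 8 / Real.cosh (r / 2) ^ (2 * k - 3)) := by positivity
    have e3 : 0 ≤ (2 * k - 1) / (2 * Real.pi * Real.sinh (r / 4) ^ 2) *
      (1 / ((2 * k - 2) * Real.cosh (r / 2) ^ (2 * k - 3)) +
        1 / ((k - 2) * Real.cosh (r / 2) ^ (2 * k - 4))) := by positivity
    linarith
  · have e1 : 0 ≤ (2 * k - 1) / (4 * Real.pi) *
      (2 + 16 / Real.cosh (r / 4) ^ (2 * k - 4) + 8 / Real.cosh (r / 2) ^ (2 * k - 3)) := by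
      positivity
    have e2 : 0 ≤ (2 * k - 1) / (2 * Real.pi * Real.sinh (r / 4) ^ 2) *
      (1 / ((2 * k - 2) * Real.cosh (r / 2) ^ (2 * k - 3))) := by positivity
    linarith

/-- With `x = 1 - tanh² (r / 4) = 1 / cosh² (r / 4)` one has `cosh (r / 2) = (2 - x) / x ≤ 1 / x²`,
and the powers of `x` in the last summand of `C_{X,k}` are bounded below by Bernoulli's
inequality. -/
theorem one_div_le_constC {r : ℝ} (hr : 0 < r) {k : ℕ} (hk : 3 ≤ k)
    (hT : Real.tanh (r / 4) ^ 2 ≤ 1 / (4 * k)) :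
    1 / (4 * Real.pi * Real.tanh (r / 4) ^ 2) ≤ constC r k := by
  refine le_trans ?_ (le_constC hr hk).2
  have hk' : (3 : ℝ) ≤ k := by exact_mod_cast hk
  have hpi := Real.pi_pos
  have h3 : (0 : ℝ) < k - 2 := by linarith
  have hs : 0 < Real.sinh (r / 4) := Real.sinh_pos_iff.2 (by positivity)
  have hc := Real.cosh_pos (r / 4)
  have hc' := Real.cosh_pos (r / 2)
  set T := Real.tanh (r / 4) with hTdef
  have hT0 : 0 < T := tanh_pos (by positivity)
  set x := 1 - T ^ 2 with hx
  have hx1 : x ≤ 1 := by nlinarith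
  have hxk : 1 - 1 / (4 * (k : ℝ)) ≤ x := by linarith
  have hhalf := half_le_pow (by omega) hxk hx1
  have hx0 : 0 < x := by
    have := hhalf 1 (by omega)
    linarith
  have hcosh : Real.cosh (r / 4) ^ 2 * x = 1 := by
    have := Real.cosh_sq (r / 4)
    rw [hx, hTdef, Real.tanh_eq_sinh_div_cosh]
    field_simp
    linarith
  have hsinh : Real.sinh (r / 4) ^ 2 * x = T ^ 2 := by
    have := Real.cosh_sq (r / 4)
    have : Real.sinh (r / 4) ^ 2 * x = Real.cosh (r / 4) ^ 2 * x - x := by rw [this]; ring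
    rw [this, hcosh, hx]
    ring
  have hcosh2 : Real.cosh (r / 2) * x = 2 - x := by
    rw [show r / 2 = 2 * (r / 4) by ring, Real.cosh_two_mul]
    linarith
  have hcx : Real.cosh (r / 2) * x ^ 2 ≤ 1 := by nlinarith [sq_nonneg (x - 1)]
  have hpow : Real.sinh (r / 4) ^ 2 * Real.cosh (r / 2) ^ (2 * k - 4) ≤ 4 * T ^ 2 := by
    have h1 : (Real.cosh (r / 2) * x ^ 2) ^ (2 * k - 4) ≤ 1 := pow_le_one₀ (by positivity) hcx
    have h2 : 1 / 4 ≤ x * (x ^ 2) ^ (2 * k - 4) := by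
      have e1 := hhalf (2 * k - 4) (by omega)
      have e2 := hhalf (2 * k - 4 + 1) (by omega)
      calc (1 : ℝ) / 4 = 1 / 2 * (1 / 2) := by norm_num
        _ ≤ x ^ (2 * k - 4) * x ^ (2 * k - 4 + 1) := by gcongr
        _ = x * (x ^ 2) ^ (2 * k - 4) := by
            rw [pow_succ, ← pow_mul, two_mul (2 * k - 4), pow_add]
            ac_rfl
    set y := Real.sinh (r / 4) ^ 2 * Real.cosh (r / 2) ^ (2 * k - 4) with hy
    have hy0 : 0 ≤ y := by positivity
    calc y = 4 * (y * (1 / 4)) := by ring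
      _ ≤ 4 * (y * (x * (x ^ 2) ^ (2 * k - 4))) := by gcongr
      _ = 4 * (Real.sinh (r / 4) ^ 2 * x * (Real.cosh (r / 2) * x ^ 2) ^ (2 * k - 4)) := by
          rw [mul_pow, hy]
          ring
      _ ≤ 4 * (Real.sinh (r / 4) ^ 2 * x * 1) := by gcongr
      _ = 4 * T ^ 2 := by rw [mul_one, hsinh]
  have hrw : (2 * k - 1) / (2 * Real.pi * Real.sinh (r / 4) ^ 2) *
        (1 / ((k - 2) * Real.cosh (r / 2) ^ (2 * k - 4)))
      = (2 * k - 1) / (2 * Real.pi * (k - 2) *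
        (Real.sinh (r / 4) ^ 2 * Real.cosh (r / 2) ^ (2 * k - 4))) := by
    field_simp
  rw [hrw]
  calc 1 / (4 * Real.pi * T ^ 2) = (2 * (k - 2)) / (2 * Real.pi * (k - 2) * (4 * T ^ 2)) := by
        field_simp
    _ ≤ (2 * k - 1) / (2 * Real.pi * (k - 2) *
        (Real.sinh (r / 4) ^ 2 * Real.cosh (r / 2) ^ (2 * k - 4))) := by
        gcongr
        · linarith
        · linarith

/-- The radius `1 / (2 √k)` used in Cauchy's estimate. -/
theorem exists_radius {k : ℕ} (hk : 3 ≤ k) :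
    ∃ R : ℝ, 0 < R ∧ R ≤ 3 / 10 ∧ R ^ 2 = 1 / (4 * k) := by
  have hk' : (3 : ℝ) ≤ k := by exact_mod_cast hk
  refine ⟨√(1 / (4 * k)), by positivity, ?_, Real.sq_sqrt (by positivity)⟩
  rw [Real.sqrt_le_left (by norm_num), div_le_iff₀ (by positivity)]
  linarith

theorem meanConst_le {k : ℕ} (hk : 3 ≤ k) {R : ℝ} (hR : 0 < R) (hR3 : R ≤ 3 / 10)
    (hRk : R ^ 2 ≤ 1 / (4 * k)) : meanConst R k ≤ 169 / 200 / (Real.pi * R ^ 2) := by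
  have hpi := Real.pi_pos
  have hhalf := half_le_pow (k := k) (x := 1 - R ^ 2) (by omega) (by linarith)
    (by linarith [sq_nonneg R]) (2 * k - 2) (by omega)
  have h1 : (1 + R) ^ 2 ≤ 169 / 100 := by nlinarith
  rw [meanConst, div_pow, div_le_div_iff₀ (by positivity) (by positivity), one_mul]
  calc Real.pi * R ^ 2 = 169 / 200 * (Real.pi * ((2 * R) ^ 2 / (169 / 100)) * (1 / 2)) := by ring
    _ ≤ _ := by gcongr

/-- The two estimates are combined with the constant `C_{X,k}`. With `T = tanh (r / 4)`, for
`T² ≥ 1 / (4 k)` the first term of `C_{X,k}` suffices, otherwise its last term is used. -/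
theorem exists_meanConst_le_constC {r : ℝ} (hr : 0 < r) {k : ℕ} (hk : 3 ≤ k) {R : ℝ} (hR : 0 < R)
    (hR3 : R ≤ 3 / 10) (hRk : R ^ 2 = 1 / (4 * k)) :
    ∃ S : ℝ, 0 < S ∧ S ≤ Real.tanh (r / 4) ∧
      meanConst S k / ((2 * R / (1 + R)) ^ 2 * (1 - R ^ 2) ^ (2 * k)) ≤ 5 * k ^ 2 * constC r k := by
  have hpi := Real.pi_pos
  have hk' : (3 : ℝ) ≤ k := by exact_mod_cast hk
  have hT0 : 0 < Real.tanh (r / 4) := tanh_pos (by positivity)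
  have hhalf := half_le_pow (k := k) (x := 1 - R ^ 2) (by omega) (by linarith)
    (by linarith [sq_nonneg R]) (2 * k) le_rfl
  have h1 : (1 + R) ^ 2 ≤ 169 / 100 := by nlinarith
  -- By `(1 + R)² ≤ 169 / 100` and `(1 - R²)^(2k) ≥ 1 / 2`, Cauchy's estimate costs a factor of at
  -- most `338 k / 100`.
  have hden : 100 / (338 * k) ≤ (2 * R / (1 + R)) ^ 2 * (1 - R ^ 2) ^ (2 * k) := by
    rw [div_pow, mul_pow, hRk] at *
    calc (100 : ℝ) / (338 * k) = 2 ^ 2 * (1 / (4 * k)) / (169 / 100) * (1 / 2) := by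
          field_simp; norm_num
      _ ≤ _ := by gcongr
  have hreduce : ∀ S : ℝ, 0 < S → S ≤ Real.tanh (r / 4) →
      meanConst S k * 338 ≤ 500 * k * constC r k →
      meanConst S k / ((2 * R / (1 + R)) ^ 2 * (1 - R ^ 2) ^ (2 * k)) ≤ 5 * k ^ 2 * constC r k := by
    intro S hS hST h
    have hM := (meanConst_pos hS (hST.trans_lt (Real.tanh_lt_one _)) k).le
    calc meanConst S k / ((2 * R / (1 + R)) ^ 2 * (1 - R ^ 2) ^ (2 * k))
        ≤ meanConst S k / (100 / (338 * k)) := by gcongr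
      _ = meanConst S k * 338 * (k / 100) := by field_simp
      _ ≤ 500 * k * constC r k * (k / 100) := by gcongr
      _ = 5 * k ^ 2 * constC r k := by ring
  rcases le_total R (Real.tanh (r / 4)) with hRT | hTR
  · refine ⟨R, hR, hRT, hreduce R hR hRT ?_⟩
    have h2 := meanConst_le hk hR hR3 hRk.le
    have h3 := (le_constC hr hk).1
    rw [hRk] at h2
    calc meanConst R k * 338 ≤ 169 / 200 / (Real.pi * (1 / (4 * k))) * 338 := by gcongr
      _ = 500 * k * ((28561 / 12500) / Real.pi) := by field_simp; norm_num
      _ ≤ 500 * k * ((2 * k - 1) / (2 * Real.pi)) := by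
          gcongr ?_ * ?_
          rw [div_le_div_iff₀ (by positivity) (by positivity)]
          nlinarith
      _ ≤ _ := by gcongr
  · have hTk : Real.tanh (r / 4) ^ 2 ≤ 1 / (4 * k) := by
      rw [← hRk]
      gcongr
    refine ⟨_, hT0, le_rfl, hreduce _ hT0 le_rfl ?_⟩
    have h2 := meanConst_le hk hT0 (hTR.trans hR3) hTk
    have h3 := one_div_le_constC hr hk hTk
    set T := Real.tanh (r / 4)
    calc meanConst T k * 338 ≤ 169 / 200 / (Real.pi * T ^ 2) * 338 := by gcongr
      _ = (28561 / 100) * (1 / (Real.pi * T ^ 2)) := by field_simp; norm_num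
      _ ≤ (375 : ℝ) * (1 / (Real.pi * T ^ 2)) := by gcongr; norm_num
      _ = 500 * 3 * (1 / (4 * Real.pi * T ^ 2)) := by field_simp; norm_num
      _ ≤ 500 * k * constC r k := by gcongr

end HypSurface

namespace HypSurface

/-! ### The bound for the Bergman metric -/

section Bergman

open scoped Topology

variable {Γ : Subgroup PSL(2, ℝ)} {k n : ℕ}

/-- The vector of the coefficient functions of the differentials `ω i`, as a function on `ℂ` which
is holomorphic on the upper half-plane. -/
noncomputable def coeffVector (ω : Fin n → kDifferentials Γ k) (w : ℂ) :
    EuclideanSpace ℂ (Fin n) :=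
  WithLp.toLp 2 fun i => (ω i).1 (ofComplex w)

theorem differentiableOn_coeffVector (ω : Fin n → kDifferentials Γ k) :
    DifferentiableOn ℂ (coeffVector ω) {w : ℂ | 0 < w.im} := by
  rw [differentiableOn_euclidean]
  exact fun i => UpperHalfPlane.mdifferentiable_iff.1 (ω i).2.1

theorem bergmanKernel_proj_ofComplex (ω : Fin n → kDifferentials Γ k) {w : ℂ} (hw : 0 < w.im) :
    bergmanKernel ω (proj Γ (ofComplex w)) = w.im ^ (2 * k) * ‖coeffVector ω w‖ ^ 2 := by
  rw [bergmanKernel, EuclideanSpace.norm_sq_eq, Finset.mul_sum]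
  refine Finset.sum_congr rfl fun i _ => ?_
  rw [hypNorm_proj, mul_pow, ← pow_mul, mul_comm k 2]
  simp only [coeffVector, ofComplex_apply_of_im_pos hw]
  rfl

theorem bergmanKernel_proj (ω : Fin n → kDifferentials Γ k) (z : ℍ) :
    bergmanKernel ω (proj Γ z) = z.im ^ (2 * k) * ‖coeffVector ω z‖ ^ 2 := by
  simpa using bergmanKernel_proj_ofComplex ω z.im_pos

theorem bergmanMetricCoeff_div (ω : Fin n → kDifferentials Γ k) (z : ℍ) :
    bergmanMetricCoeff ω z / hypMetricCoeff z =
      -((z.im : ℂ) ^ 2 / Real.pi) * ddbarCoeff (logWeighted k (coeffVector ω)) z := by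
  have hev : (fun w : ℂ => ((Real.log (bergmanKernel ω (proj Γ (ofComplex w))) : ℝ) : ℂ))
      =ᶠ[𝓝 (z : ℂ)] logWeighted k (coeffVector ω) := by
    filter_upwards [isOpen_upperHalfPlaneSet.mem_nhds z.im_pos] with w hw
    rw [bergmanKernel_proj_ofComplex ω hw, logWeighted]
  have hev' := hev.eventually_nhds.mono fun w hw => wirtingerZbar_congr hw
  have hz : (z.im : ℂ) ≠ 0 := by exact_mod_cast z.im_ne_zero
  have hpi : (Real.pi : ℂ) ≠ 0 := by exact_mod_cast Real.pi_ne_zero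
  rw [bergmanMetricCoeff, hypMetricCoeff, ddbarCoeff, wirtingerZ_congr hev', ← ddbarCoeff]
  field_simp [Complex.I_ne_zero]

end Bergman

end HypSurface

open HypSurface in
theorem theorem2p5 (Γ : Subgroup PSL(2, ℝ)) (hΓ : IsSurfaceGroup Γ)
    (F : Set ℍ) (hF : IsFundamentalDomain Γ F (volume : Measure ℍ))
    (k : ℕ) (hk : 3 ≤ k) :
    (∃ (n : ℕ) (ω : Module.Basis (Fin n) ℂ (kDifferentials Γ k)), IsL2Orthonormal F ω) ∧
    ∀ (n : ℕ) (ω : Module.Basis (Fin n) ℂ (kDifferentials Γ k)), IsL2Orthonormal F ω →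
      ∀ z : ℍ,
        ‖bergmanMetricCoeff ω z / hypMetricCoeff z‖ ≤
          (k : ℝ) ^ 2 / Real.pi *
              (constC (injRadius Γ) k / bergmanKernel ω (proj Γ z)) *
              (4 * constC (injRadius Γ) k / bergmanKernel ω (proj Γ z) + 5 + 1 / (2 * k)) +
            k / (2 * Real.pi) := by
  refine ⟨exists_l2Orthonormal_basis hΓ hF (by omega), fun n ω hω z => ?_⟩
  have hpi := Real.pi_pos
  have hk' : (3 : ℝ) ≤ k := by exact_mod_cast hk
  have hr := hΓ.injRadius_pos
  have hy := z.im_pos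
  set C := constC (injRadius Γ) k
  have hC : 0 ≤ C := by
    refine (le_constC hr hk).1.trans' (div_nonneg ?_ (by positivity))
    linarith
  have hV := differentiableOn_coeffVector (fun i => ω i)
  have hVan : AnalyticAt ℂ (coeffVector fun i => ω i) z :=
    hV.analyticAt (isOpen_upperHalfPlaneSet.mem_nhds z.im_pos)
  have hB := bergmanKernel_proj (fun i => ω i) z
  rw [bergmanMetricCoeff_div]
  set V := coeffVector fun i => ω i
  set B := bergmanKernel (fun i => ω i) (proj Γ z)
  have hB0 : 0 ≤ B := by rw [hB]; positivity
  rcases eq_or_ne (V z) 0 with h0 | hne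
  · -- At a common zero of the differentials both `1 / B` and the derivatives of `log B` take their
    -- default value `0`. (By Riemann-Roch there are no such points, but this is not needed.)
    rw [ddbarCoeff_logWeighted_of_eq_zero hVan hy h0, mul_zero, norm_zero]
    positivity
  have hBpos : 0 < B := by
    rw [hB]
    have := norm_pos_iff.2 hne
    positivity
  obtain ⟨R, hR, hR3, hRk⟩ := exists_radius hk
  obtain ⟨S, hS, hST, hSC⟩ := exists_meanConst_le_constC hr hk hR hR3 hRk
  have hbound : ∀ w : ℂ, 0 < w.im → w.im ^ (2 * k) * ‖V w‖ ^ 2 ≤ meanConst S k := fun w hw => by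
    rw [← bergmanKernel_proj_ofComplex (fun i => ω i) hw]
    exact bergmanKernel_le hΓ hF (by omega) hS hST hω _
  have hlevi := (leviForm_le_of_weighted_norm_le z hV hbound hR (by linarith)).trans hSC
  rw [← hB] at hlevi
  set Q := leviForm (V z) (deriv V z)
  have hQ : 0 ≤ Q := leviForm_nonneg _ _
  have hQ' : z.im ^ 2 * Q ≤ 5 * k ^ 2 * C / B := by
    rw [le_div_iff₀ hBpos]
    linarith
  rw [ddbarCoeff_logWeighted_eq_ofReal hVan hy hne]
  have hval : -((z.im : ℂ) ^ 2 / Real.pi) *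
      ((-(k / (2 * (z : ℂ).im ^ 2)) + Q : ℝ) : ℂ)
      = ((k / (2 * Real.pi) - z.im ^ 2 * Q / Real.pi : ℝ) : ℂ) := by
    norm_cast
    rw [coe_im]
    field_simp
    ring
  rw [hval, Complex.norm_real, Real.norm_eq_abs]
  have h1 : z.im ^ 2 * Q / Real.pi ≤ k ^ 2 / Real.pi * (C / B) * 5 := by
    rw [div_le_iff₀ hpi]
    refine hQ'.trans (le_of_eq ?_)
    field_simp
  have h2 : k ^ 2 / Real.pi * (C / B) * 5
      ≤ k ^ 2 / Real.pi * (C / B) * (4 * C / B + 5 + 1 / (2 * k)) := by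
    have e1 : 0 ≤ 4 * C / B := by positivity
    have e2 : 0 ≤ 1 / (2 * (k : ℝ)) := by positivity
    gcongr
    linarith
  have h3 : 0 ≤ z.im ^ 2 * Q / Real.pi := by positivity
  have h4 : 0 ≤ (k : ℝ) / (2 * Real.pi) := by positivity
  rw [abs_le]
  constructor <;> linarith
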